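/- Let $S_1,S_2$ be independent $\mathrm{Bernoulli}(1/2)$ variables and consider the binary doubly-dirty multiple access channel $Y=X_1\oplus X_2\oplus S_1\oplus S_2$, where $S_i$ is known noncausally to user $i$ only. Write $H_b(x)=-x\log_2 x-(1-x)\log_2(1-x)$ and $[x]^+=\max\{0,x\}$; rates are in bits and nonnegative. For auxiliary variables $U_1,U_2$ with finite alphabets and a law $P(u_1,x_1,u_2,x_2\mid s_1,s_2)=P(u_1,x_1\mid s_1)\,P(u_2,x_2\mid s_2)$, let $\mathcal R(U_1,U_2)$ be the set of all pairs $(R_1,R_2)$ with $R_1,R_2\ge 0$ and $$R_1\le I(U_1;Y\mid U_2)-I(U_1;S_1),\qquad R_2\le I(U_2;Y\mid U_1)-I(U_2;S_2),$$ $$R_1+R_2\le I(U_1,U_2;Y)-I(U_1;S_1)-I(U_2;S_2).$$ For $0\le q\le 1/2$ let the best known single-letter region $\mathcal R_{BSL}(q)$ be the closure of the set of rate pairs obtained by time sharing between such schemes under the input constraints $EX_1,EX_2\le q$ on the time-shared inputs, i.e. the closure of the set of all finite sums $\sum_k\lambda_k r^{(k)}$ with $\lambda_k\ge0$, $\sum_k\lambda_k=1$,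 $r^{(k)}\in\mathcal R(U_1^{(k)},U_2^{(k)})$ and $\sum_k\lambda_k EX_i^{(k)}\le q$ for $i=1,2$. Theorem. For every $0\le q\le 1/2$, $\mathcal R_{BSL}(q)$ is the triangle $$\mathcal R_{BSL}(q)=\Big\{(R_1,R_2): R_1,R_2\ge0,\ R_1+R_2\le \mathrm{u.c.e.}\big[2H_b(q)-1\big]^+\Big\},$$ where u.c.e. is the upper convex envelope (least concave majorant) with respect to $q\in[0,1/2]$. With $q^*=1-1/\sqrt2$ and $C^*=(2H_b(q^*)-1)/q^*$, this envelope equals $2H_b(q)-1$ for $q^*\le q\le 1/2$ and $C^*q$ for $0\le q\le q^*$. The region $\mathcal R_{BSL}(q)$ is contained in the capacity region of the channel with input constraints $\frac1n w_H(\mathbf x_i)\le q$, $i=1,2$ (the closure of the set of rate pairs achievable by block codes with vanishing average error probability, where encoder $i$ knows its message and its interference vector $\mathbf s_i$). For $0<q<1/2$ it is strictly contained in this capacity region, and also in the set $\{(R_1,R_2):R_1,R_2\ge 0,\ R_1+R_2\le H_b(q)\}$. -/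

import Mathlib

noncomputable section

namespace DoublyDirty

/-! ### Entropy and mutual information (in bits) of random variables on a finite sample space -/

/-- `P(X = a)` for a random variable `X` on a finite sample space with mass function `p`. -/
def prob {Ω α : Type*} [Fintype Ω] [DecidableEq α] (p : Ω → ℝ) (X : Ω → α) (a : α) : ℝ :=
  ∑ ω with X ω = a, p ω

/-- Shannon entropy `H(X) = -∑ P(X = a) log₂ P(X = a)`. -/
def entropy {Ω α : Type*} [Fintype Ω] [Fintype α] [DecidableEq α] (p : Ω → ℝ) (X : Ω → α) : ℝ :=
  ∑ a, Real.negMulLog (prob p X a) / Real.log 2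

/-- Mutual information `I(X; Y) = H(X) + H(Y) - H(X, Y)`. -/
def mutualInfo {Ω α β : Type*} [Fintype Ω] [Fintype α] [DecidableEq α] [Fintype β]
    [DecidableEq β] (p : Ω → ℝ) (X : Ω → α) (Y : Ω → β) : ℝ :=
  entropy p X + entropy p Y - entropy p (fun ω => (X ω, Y ω))

/-- Conditional mutual information
`I(X; Y | Z) = H(X | Z) + H(Y | Z) - H(X, Y | Z) = H(X, Z) + H(Y, Z) - H(X, Y, Z) - H(Z)`. -/
def condMutualInfo {Ω α β γ : Type*} [Fintype Ω] [Fintype α] [DecidableEq α] [Fintype β]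
    [DecidableEq β] [Fintype γ] [DecidableEq γ]
    (p : Ω → ℝ) (X : Ω → α) (Y : Ω → β) (Z : Ω → γ) : ℝ :=
  entropy p (fun ω => (X ω, Z ω)) + entropy p (fun ω => (Y ω, Z ω))
    - entropy p (fun ω => (X ω, Y ω, Z ω)) - entropy p Z

/-- The binary entropy function `H_b(x) = -x log₂ x - (1 - x) log₂ (1 - x)`. -/
def Hb (x : ℝ) : ℝ := Real.binEntropy x / Real.log 2

/-! ### The single-letter region of the binary doubly-dirty MAC -/

/-- The realisations `(s, u, x)` of the state, auxiliary variable and input of one user,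
the auxiliary alphabet having `m` letters. -/
abbrev UserSpace (m : ℕ) : Type := ZMod 2 × Fin m × ZMod 2

/-- The realisations of `((S₁, U₁, X₁), (S₂, U₂, X₂))`. -/
abbrev Space (m₁ m₂ : ℕ) : Type := UserSpace m₁ × UserSpace m₂

/-- A conditional law `P(u, x | s)` for one user. -/
def IsKernel {m : ℕ} (κ : ZMod 2 → Fin m × ZMod 2 → ℝ) : Prop :=
  ∀ s, κ s ∈ stdSimplex ℝ (Fin m × ZMod 2)

/-- The joint law `P(s₁) P(s₂) P(u₁, x₁ | s₁) P(u₂, x₂ | s₂)`, where the states are independent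
and `Bernoulli(1/2)`. -/
def law {m₁ m₂ : ℕ} (κ₁ : ZMod 2 → Fin m₁ × ZMod 2 → ℝ) (κ₂ : ZMod 2 → Fin m₂ × ZMod 2 → ℝ) :
    Space m₁ m₂ → ℝ :=
  fun ω => (1 / 2 * κ₁ ω.1.1 ω.1.2) * (1 / 2 * κ₂ ω.2.1 ω.2.2)

section RandomVariables

variable {m₁ m₂ : ℕ}

def S1 (ω : Space m₁ m₂) : ZMod 2 := ω.1.1
def U1 (ω : Space m₁ m₂) : Fin m₁ := ω.1.2.1
def X1 (ω : Space m₁ m₂) : ZMod 2 := ω.1.2.2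
def S2 (ω : Space m₁ m₂) : ZMod 2 := ω.2.1
def U2 (ω : Space m₁ m₂) : Fin m₂ := ω.2.2.1
def X2 (ω : Space m₁ m₂) : ZMod 2 := ω.2.2.2

/-- The channel output `Y = X₁ ⊕ X₂ ⊕ S₁ ⊕ S₂`. -/
def Y (ω : Space m₁ m₂) : ZMod 2 := X1 ω + X2 ω + S1 ω + S2 ω

end RandomVariables

/-- The pentagon `R(U₁, U₂)` of nonnegative rate pairs belonging to a choice of `P(u₁, x₁ | s₁)`
and `P(u₂, x₂ | s₂)`. -/
def pentagon {m₁ m₂ : ℕ} (κ₁ : ZMod 2 → Fin m₁ × ZMod 2 → ℝ)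
    (κ₂ : ZMod 2 → Fin m₂ × ZMod 2 → ℝ) : Set (ℝ × ℝ) :=
  {R | 0 ≤ R.1 ∧ 0 ≤ R.2 ∧
    R.1 ≤ condMutualInfo (law κ₁ κ₂) U1 Y U2 - mutualInfo (law κ₁ κ₂) U1 S1 ∧
    R.2 ≤ condMutualInfo (law κ₁ κ₂) U2 Y U1 - mutualInfo (law κ₁ κ₂) U2 S2 ∧
    R.1 + R.2 ≤ mutualInfo (law κ₁ κ₂) (fun ω => (U1 ω, U2 ω)) Y
      - mutualInfo (law κ₁ κ₂) U1 S1 - mutualInfo (law κ₁ κ₂) U2 S2}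

/-- All `((R₁, R₂), (E X₁, E X₂))` with `(R₁, R₂) ∈ R(U₁, U₂)`, over all finite auxiliary
alphabets and all `P(u₁, x₁ | s₁) P(u₂, x₂ | s₂)`. -/
def rateCostSet : Set ((ℝ × ℝ) × (ℝ × ℝ)) :=
  {v | ∃ (m₁ m₂ : ℕ) (κ₁ : ZMod 2 → Fin m₁ × ZMod 2 → ℝ) (κ₂ : ZMod 2 → Fin m₂ × ZMod 2 → ℝ),
    IsKernel κ₁ ∧ IsKernel κ₂ ∧ v.1 ∈ pentagon κ₁ κ₂ ∧
    v.2 = (prob (law κ₁ κ₂) X1 1, prob (law κ₁ κ₂) X2 1)}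

/-- The best known single-letter region: the closure of the set of the rate pairs obtained by time
sharing (finite convex combinations) between single-letter schemes, where the input constraints
`E X₁ ≤ q₁`, `E X₂ ≤ q₂` are imposed on the time-shared inputs: a convex combination of points of
`rateCostSet` averages the rates and the expected inputs with the same weights. -/
def bslRegion (q₁ q₂ : ℝ) : Set (ℝ × ℝ) :=
  closure {R | ∃ c : ℝ × ℝ, (R, c) ∈ convexHull ℝ rateCostSet ∧ c.1 ≤ q₁ ∧ c.2 ≤ q₂}

/-! ### The upper convex envelope -/

/-- The upper convex envelope (least concave majorant) on `s` of the function `f`. -/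
def upperConvexEnvelope (s : Set ℝ) (f : ℝ → ℝ) (x : ℝ) : ℝ :=
  sInf {y | ∃ g : ℝ → ℝ, ConcaveOn ℝ s g ∧ (∀ z ∈ s, f z ≤ g z) ∧ y = g x}

/-- The envelope over `0 ≤ q ≤ 1/2` of `[2 H_b(q) - 1]⁺`. -/
def bslSumRate (q : ℝ) : ℝ :=
  upperConvexEnvelope (Set.Icc 0 (1 / 2)) (fun p => max 0 (2 * Hb p - 1)) q

/-- `q* = 1 - 1/√2`. -/
def qStar : ℝ := 1 - 1 / √2

/-- `C* = (2 H_b(q*) - 1) / q*`. -/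
def CStar : ℝ := (2 * Hb qStar - 1) / qStar

/-! ### The capacity region of the binary doubly-dirty MAC -/

/-- A block code of length `n` with `M₁` and `M₂` messages: each encoder sees its own message and
(noncausally) its own interference vector, the decoder sees the output only. -/
structure Code (n M₁ M₂ : ℕ) where
  enc₁ : Fin M₁ → (Fin n → ZMod 2) → (Fin n → ZMod 2)
  enc₂ : Fin M₂ → (Fin n → ZMod 2) → (Fin n → ZMod 2)
  dec : (Fin n → ZMod 2) → Fin M₁ × Fin M₂

/-- The input constraints: every codeword of user `i` has Hamming weight at most `n qᵢ`. -/
def Code.MeetsConstraint {n M₁ M₂ : ℕ} (c : Code n M₁ M₂) (q₁ q₂ : ℝ) : Prop :=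
  (∀ w s, (hammingNorm (c.enc₁ w s) : ℝ) ≤ n * q₁) ∧
  (∀ w s, (hammingNorm (c.enc₂ w s) : ℝ) ≤ n * q₂)

/-- The probability of a decoding error when the messages and the interference vectors are
independent and uniform. -/
def Code.errorProb {n M₁ M₂ : ℕ} (c : Code n M₁ M₂) : ℝ :=
  (Finset.univ.filter
      (fun v : (Fin M₁ × Fin M₂) × (Fin n → ZMod 2) × (Fin n → ZMod 2) =>
        c.dec (c.enc₁ v.1.1 v.2.1 + c.enc₂ v.1.2 v.2.2 + v.2.1 + v.2.2) ≠ v.1)).card /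
    (M₁ * M₂ * 2 ^ n * 2 ^ n : ℝ)

/-- `(R₁, R₂)` is achievable: for every `ε > 0` and all large block lengths there is a code that
meets the input constraints, has rates at least `R₁`, `R₂` and error probability at most `ε`. -/
def Achievable (q₁ q₂ : ℝ) (R : ℝ × ℝ) : Prop :=
  0 ≤ R.1 ∧ 0 ≤ R.2 ∧
  ∀ ε : ℝ, 0 < ε → ∃ N : ℕ, ∀ n : ℕ, N ≤ n → ∃ (M₁ M₂ : ℕ) (c : Code n M₁ M₂),
    c.MeetsConstraint q₁ q₂ ∧ R.1 ≤ Real.logb 2 M₁ / n ∧ R.2 ≤ Real.logb 2 M₂ / n ∧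
    c.errorProb ≤ ε

/-- The capacity region: the closure of the set of achievable rate pairs. -/
def capacityRegion (q₁ q₂ : ℝ) : Set (ℝ × ℝ) := closure {R | Achievable q₁ q₂ R}

/-- The nonnegative rate pairs with `R₁ + R₂ ≤ min {H_b(q₁), H_b(q₂)}`. -/
def capacityFormula (q₁ q₂ : ℝ) : Set (ℝ × ℝ) :=
  {R | 0 ≤ R.1 ∧ 0 ≤ R.2 ∧ R.1 + R.2 ≤ min (Hb q₁) (Hb q₂)}

end DoublyDirty

end

noncomputable section
namespace DoublyDirty

/-! ### Tangent lines of `2 H_b - 1` -/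

/-! Converse. Since `S_i` is a fair bit, `I(U_i;S_i) = 1 - H(S_i|U_i)`. Put `Z_i = X_i ⊕ S_i`, so
that `Y = Z_1 ⊕ Z_2`. Given `(U_1,U_2)` the bits `Z_1, Z_2` are independent, so `H(Y|U_1,U_2)` is at
least each `H(Z_i|U_i)`, hence at least their average. With `H(Y) ≤ 1` the sum rate is at most half
the sum over `i = 1, 2` of `2 H(S_i|U_i) - H(Z_i|U_i) - 1`, and the two users decouple.

For one user, fix `U = u` and let `s`, `t` be the conditional probabilities that `S = 1` and `Z =
1`. They differ by at most `P(X = 1 | u)`. The key inequality `Hb_sub_Hb_le_tangent` bounds `2 Hb s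
- Hb t - 1` by the tangent line of `2 Hb - 1` at any `p ∈ [qStar, 1/2]`, evaluated at this
conditional cost. An affine bound survives both averaging over `u` and time sharing, so no concavity
of an optimised rate function is needed. For `p = max q qStar` the tangent takes the value of the
envelope at `q`; `qStar` is the point whose tangent passes through the origin.

Direct part. `U = X ⊕ S` with `X` independent of `S` gives every nonnegative pair of sum rate at
most `2 Hb p - 1` (`mem_pentagon_dirtyKernel`). Below `qStar` this scheme at `qStar` is time-shared
with an idle one.

Capacity. Only the inner bound `R_1 + R_2 ≤ Hb q` is needed. A suitable linear syndrome map sends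
the Hamming ball of radius `n q` onto almost all syndromes (`exists_covering_matrix`). Each user
sends a ball element whose syndrome is its message plus the syndrome of its interference.
Interference then cancels in the output syndrome, and the messages sit in disjoint coordinates.
Strictness follows because the envelope lies below `Hb q` for `0 < q < 1/2`, so the corner `(Hb q,
0)` is missed. -/

lemma Hb_nonneg {x : ℝ} (h₀ : 0 ≤ x) (h₁ : x ≤ 1) : 0 ≤ Hb x :=
  div_nonneg (Real.binEntropy_nonneg h₀ h₁) (Real.log_pos one_lt_two).le

lemma Hb_le_one (x : ℝ) : Hb x ≤ 1 :=
  (div_le_one (Real.log_pos one_lt_two)).2 Real.binEntropy_le_log_two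

@[simp] lemma Hb_zero : Hb 0 = 0 := by simp [Hb]

lemma Hb_one_sub (x : ℝ) : Hb (1 - x) = Hb x := by simp [Hb]

lemma Hb_half : Hb (1 / 2) = 1 := by
  have := (Real.log_pos one_lt_two).ne'
  rw [Hb, one_div, Real.binEntropy_two_inv, div_self this]

lemma Hb_lt_one {x : ℝ} (h : x ≠ 1 / 2) : Hb x < 1 := by
  rw [Hb, div_lt_one (Real.log_pos one_lt_two)]
  exact Real.binEntropy_lt_log_two.2 (by rwa [one_div] at h)

lemma continuous_Hb : Continuous Hb := Real.binEntropy_continuous.div_const _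

lemma concaveOn_Hb : ConcaveOn ℝ (Set.Icc 0 1) Hb := by
  have := Real.strictConcave_binEntropy.concaveOn.smul
    (inv_nonneg.2 (Real.log_pos one_lt_two).le)
  refine this.congr fun x _ => ?_
  simp [Hb, div_eq_inv_mul]

/-- The tangent line at `p` of the function `2 H_b - 1`. -/
def tangent (p d : ℝ) : ℝ :=
  2 * ((-(d * Real.log p) - (1 - d) * Real.log (1 - p)) / Real.log 2) - 1

lemma tangent_self (p : ℝ) : tangent p p = 2 * Hb p - 1 := by
  rw [tangent, Hb, Real.binEntropy_eq_negMulLog_add_negMulLog_one_sub, Real.negMulLog,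
    Real.negMulLog]
  ring

lemma tangent_affine (p a b x y : ℝ) (h : a + b = 1) :
    tangent p (a * x + b * y) = a * tangent p x + b * tangent p y := by
  obtain rfl : b = 1 - a := by linarith
  simp only [tangent]
  ring

lemma tangent_eq (p d : ℝ) :
    tangent p d = tangent p 0 + d * (tangent p 1 - tangent p 0) := by
  simp only [tangent]
  ring

/-- This is `log x ≤ x - 1` at `x = p / s`. The error `p - s` is kept because it cancels against the
one for `1 - s`, `1 - p`. -/
lemma negMulLog_le {s p : ℝ} (hs : 0 ≤ s) (hp : 0 < p) :
    Real.negMulLog s ≤ -(s * Real.log p) + (p - s) := by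
  rcases hs.eq_or_lt with rfl | hs
  · simpa using hp.le
  · have h := Real.log_le_sub_one_of_pos (div_pos hp hs)
    rw [Real.log_div hp.ne' hs.ne'] at h
    have h' := mul_le_mul_of_nonneg_left h hs.le
    have : s * (p / s - 1) = p - s := by field_simp
    rw [this] at h'
    rw [Real.negMulLog]
    linarith

lemma Hb_le_tangent {s p : ℝ} (hs₀ : 0 ≤ s) (hs₁ : s ≤ 1) (hp₀ : 0 < p) (hp₁ : p < 1) :
    2 * Hb s - 1 ≤ tangent p s := by
  have h₁ := negMulLog_le hs₀ hp₀
  have h₂ := negMulLog_le (sub_nonneg.2 hs₁) (sub_pos.2 hp₁)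
  have h : Hb s ≤ (-(s * Real.log p) - (1 - s) * Real.log (1 - p)) / Real.log 2 := by
    rw [Hb, Real.binEntropy_eq_negMulLog_add_negMulLog_one_sub]
    have := Real.log_pos one_lt_two
    gcongr
    linarith
  rw [tangent]
  linarith

/-- The slope is `2 log₂ ((1 - p) / p)`, nonnegative up to `p = 1/2`. This lets costs be replaced by
upper bounds. -/
lemma tangent_mono {p : ℝ} (hp₀ : 0 < p) (hp₁ : p ≤ 1 / 2) : Monotone (tangent p) := by
  intro a b hab
  have h : Real.log p ≤ Real.log (1 - p) := Real.log_le_log hp₀ (by linarith)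
  have := Real.log_pos one_lt_two
  unfold tangent
  gcongr 2 * (?_ / _) - 1
  nlinarith

lemma qStar_pos : 0 < qStar := by
  have : 1 < √2 := by rw [Real.lt_sqrt] <;> norm_num
  have : 1 / √2 < 1 := by rw [div_lt_one] <;> linarith
  rw [qStar]; linarith

lemma qStar_lt_half : qStar < 1 / 2 := by
  have h : √2 < 2 := by rw [Real.sqrt_lt'] <;> norm_num
  have : 1 / 2 < 1 / √2 := one_div_lt_one_div_of_lt (by positivity) h
  rw [qStar]; linarith

lemma tangent_zero (p : ℝ) : tangent p 0 = -2 * (Real.log (1 - p) / Real.log 2) - 1 := by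
  simp only [tangent]; ring

/-- Here `1 - qStar = 2 ^ (-1/2)`, which is exactly the condition that the tangent goes through the
origin. -/
lemma tangent_qStar_zero : tangent qStar 0 = 0 := by
  have := (Real.log_pos one_lt_two).ne'
  rw [tangent_zero, qStar, sub_sub_cancel, one_div, Real.log_inv, Real.log_sqrt (by norm_num)]
  field_simp
  ring

lemma tangent_zero_nonneg {p : ℝ} (hp : qStar ≤ p) (hp₁ : p ≤ 1 / 2) : 0 ≤ tangent p 0 := by
  have h₀ := tangent_qStar_zero
  rw [tangent_zero] at h₀ ⊢
  have := Real.log_pos one_lt_two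
  have h : Real.log (1 - p) ≤ Real.log (1 - qStar) := Real.log_le_log (by linarith) (by linarith)
  have : Real.log (1 - p) / Real.log 2 ≤ Real.log (1 - qStar) / Real.log 2 := by gcongr
  linarith

lemma tangent_qStar (d : ℝ) : tangent qStar d = CStar * d := by
  have h := tangent_eq qStar d
  have h' := tangent_eq qStar qStar
  rw [tangent_self, tangent_qStar_zero] at h'
  have := qStar_pos.ne'
  rw [h, tangent_qStar_zero, CStar, h']
  field_simp
  ring

/-- Write `t = r s`. Concavity with `Hb 0 = 0` gives `Hb t ≥ r Hb s`, so the left side is at most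
`(1 - r)(2 Hb s - 1) + r (Hb s - 1)`. The first bracket is below the tangent at `s`, the second is
at most `0`, hence below the tangent at `0`. The affine combination is the tangent at `(1 - r) s = s
- t`. -/
lemma Hb_sub_Hb_le_tangent_aux {p s t : ℝ} (hp : qStar ≤ p) (hp₁ : p ≤ 1 / 2) (ht : 0 ≤ t)
    (hts : t ≤ s) (hs : s ≤ 1) : 2 * Hb s - Hb t - 1 ≤ tangent p (s - t) := by
  have hp₀ : 0 < p := qStar_pos.trans_le hp
  have hz := tangent_zero_nonneg hp hp₁
  rcases (ht.trans hts).eq_or_lt with rfl | hs₀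
  · obtain rfl : t = 0 := le_antisymm hts ht
    simp only [Hb_zero, sub_zero]
    linarith
  obtain ⟨r, rfl⟩ : ∃ r, t = r * s := ⟨t / s, by field_simp⟩
  have hr₀ : 0 ≤ r := nonneg_of_mul_nonneg_left ht hs₀
  have hr₁ : r ≤ 1 := le_of_mul_le_mul_right (by linarith) hs₀
  have hc := concaveOn_Hb.2 ⟨hs₀.le, hs⟩ ⟨le_rfl, zero_le_one⟩ hr₀ (sub_nonneg.2 hr₁) (by ring)
  simp only [smul_eq_mul, Hb_zero, mul_zero, add_zero] at hc
  have ht := tangent_affine p (1 - r) r s 0 (by ring)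
  rw [show (1 - r) * s + r * 0 = s - r * s by ring] at ht
  rw [ht]
  have h₁ := mul_le_mul_of_nonneg_left (Hb_le_tangent hs₀.le hs hp₀ (by linarith : p < 1))
    (sub_nonneg.2 hr₁)
  have h₂ := mul_le_mul_of_nonneg_left hz hr₀
  have h₃ := mul_le_mul_of_nonneg_left (Hb_le_one s) hr₀
  linarith

lemma Hb_sub_Hb_le_tangent {p s t c : ℝ} (hp : qStar ≤ p) (hp₁ : p ≤ 1 / 2)
    (hs : s ∈ Set.Icc (0 : ℝ) 1) (ht : t ∈ Set.Icc (0 : ℝ) 1) (hc : |s - t| ≤ c) :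
    2 * Hb s - Hb t - 1 ≤ tangent p c := by
  refine le_trans ?_ (tangent_mono (qStar_pos.trans_le hp) hp₁ hc)
  rcases le_total t s with h | h
  · rw [abs_of_nonneg (sub_nonneg.2 h)]
    exact Hb_sub_Hb_le_tangent_aux hp hp₁ ht.1 h hs.2
  -- The symmetry `x ↦ 1 - x` of `Hb` exchanges the order of `s` and `t`.
  · rw [abs_of_nonpos (sub_nonpos.2 h), ← Hb_one_sub s, ← Hb_one_sub t]
    have := Hb_sub_Hb_le_tangent_aux (s := 1 - s) (t := 1 - t) hp hp₁ (by linarith [ht.2])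
      (by linarith) (by linarith [hs.1])
    rwa [show 1 - s - (1 - t) = -(s - t) by ring] at this

/-! ### The upper convex envelope of `[2 H_b - 1]⁺` -/

lemma concaveOn_tangent (p : ℝ) (s : Set ℝ) (hs : Convex ℝ s) : ConcaveOn ℝ s (tangent p) :=
  ⟨hs, fun x _ y _ a b _ _ h => by simp only [smul_eq_mul]; rw [tangent_affine p a b x y h]⟩

lemma max_le_tangent {p z : ℝ} (hp : qStar ≤ p) (hp₁ : p ≤ 1 / 2)
    (hz : z ∈ Set.Icc (0 : ℝ) (1 / 2)) : max 0 (2 * Hb z - 1) ≤ tangent p z := by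
  have hp₀ := qStar_pos.trans_le hp
  exact max_le ((tangent_zero_nonneg hp hp₁).trans (tangent_mono hp₀ hp₁ hz.1))
    (Hb_le_tangent hz.1 (by linarith [hz.2]) hp₀ (by linarith))

lemma bslSumRate_eq_tangent {p q : ℝ} (hp : qStar ≤ p) (hp₁ : p ≤ 1 / 2)
    (h : ∀ g : ℝ → ℝ, ConcaveOn ℝ (Set.Icc 0 (1 / 2)) g →
      (∀ z ∈ Set.Icc (0 : ℝ) (1 / 2), max 0 (2 * Hb z - 1) ≤ g z) → tangent p q ≤ g q) :
    bslSumRate q = tangent p q := by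
  refine IsLeast.csInf_eq ⟨⟨tangent p, concaveOn_tangent p _ (convex_Icc _ _),
    fun z hz => max_le_tangent hp hp₁ hz, rfl⟩, ?_⟩
  rintro _ ⟨g, hg, hfg, rfl⟩
  exact h g hg hfg

lemma bslSumRate_of_qStar_le {q : ℝ} (hq : qStar ≤ q) (hq₁ : q ≤ 1 / 2) :
    bslSumRate q = 2 * Hb q - 1 := by
  rw [← tangent_self]
  refine bslSumRate_eq_tangent hq hq₁ fun g _ hfg => ?_
  rw [tangent_self]
  exact (le_max_right _ _).trans (hfg q ⟨qStar_pos.le.trans hq, hq₁⟩)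

lemma bslSumRate_of_le_qStar {q : ℝ} (hq₀ : 0 ≤ q) (hq : q ≤ qStar) :
    bslSumRate q = CStar * q := by
  rw [← tangent_qStar]
  refine bslSumRate_eq_tangent le_rfl qStar_lt_half.le fun g hg hfg => ?_
  have hr₀ : 0 ≤ q / qStar := div_nonneg hq₀ qStar_pos.le
  have hr₁ : q / qStar ≤ 1 := (div_le_one qStar_pos).2 hq
  have h0 : (0 : ℝ) ∈ Set.Icc (0 : ℝ) (1 / 2) := ⟨le_rfl, by norm_num⟩
  have hs : qStar ∈ Set.Icc (0 : ℝ) (1 / 2) := ⟨qStar_pos.le, qStar_lt_half.le⟩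
  -- A concave majorant lies above its chord from `0` to `qStar`, and that chord dominates the
  -- tangent there.
  have hc := hg.2 hs h0 hr₀ (sub_nonneg.2 hr₁) (by ring)
  simp only [smul_eq_mul, mul_zero, add_zero, div_mul_cancel₀ _ qStar_pos.ne'] at hc
  have h1 := mul_le_mul_of_nonneg_left ((le_max_right _ _).trans (hfg _ hs)) hr₀
  have h2 := mul_le_mul_of_nonneg_left ((le_max_left _ _).trans (hfg _ h0)) (sub_nonneg.2 hr₁)
  have : tangent qStar q = q / qStar * (2 * Hb qStar - 1) := by
    rw [tangent_qStar, CStar]; ring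
  linarith

lemma exists_bslSumRate_eq_tangent {q : ℝ} (hq₀ : 0 ≤ q) (hq₁ : q ≤ 1 / 2) :
    ∃ p, qStar ≤ p ∧ p ≤ 1 / 2 ∧ bslSumRate q = tangent p q := by
  rcases le_total qStar q with h | h
  · exact ⟨q, h, hq₁, by rw [bslSumRate_of_qStar_le h hq₁, tangent_self]⟩
  · exact ⟨qStar, le_rfl, qStar_lt_half.le, by rw [bslSumRate_of_le_qStar hq₀ h, tangent_qStar]⟩

/-- Above `qStar` this is `Hb ≤ 1`. Below it, with `r = q / qStar`, the envelope is `r (2 Hb qStar -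
1)`, which is at most `r Hb qStar`, and `r Hb qStar ≤ Hb q` by concavity. -/
lemma bslSumRate_le_Hb {q : ℝ} (hq₀ : 0 ≤ q) (hq₁ : q ≤ 1 / 2) :
    bslSumRate q ≤ Hb q ∧ (0 < q → q < 1 / 2 → bslSumRate q < Hb q) := by
  rcases le_total qStar q with h | h
  · rw [bslSumRate_of_qStar_le h hq₁]
    exact ⟨by linarith [Hb_le_one q], fun _ h' => by linarith [Hb_lt_one h'.ne]⟩
  · rw [bslSumRate_of_le_qStar hq₀ h, CStar]
    have hr₀ : 0 ≤ q / qStar := div_nonneg hq₀ qStar_pos.le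
    have hr₁ : q / qStar ≤ 1 := (div_le_one qStar_pos).2 h
    have hs₁ := qStar_lt_half
    have hc := concaveOn_Hb.2 (⟨qStar_pos.le, by linarith⟩ : qStar ∈ Set.Icc (0 : ℝ) 1)
      ⟨le_rfl, zero_le_one⟩ hr₀ (sub_nonneg.2 hr₁) (by ring)
    simp only [smul_eq_mul, Hb_zero, mul_zero, add_zero, div_mul_cancel₀ _ qStar_pos.ne'] at hc
    have h1 := Hb_lt_one hs₁.ne
    have e : (2 * Hb qStar - 1) / qStar * q = q / qStar * (2 * Hb qStar - 1) := by ring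
    rw [e]
    refine ⟨?_, fun hq _ => ?_⟩
    · nlinarith
    · have : 0 < q / qStar := div_pos hq qStar_pos
      nlinarith

/-! ### Entropy calculus on finite sample spaces -/

section Entropy

set_option linter.unusedSectionVars false

variable {Ω Ω₁ Ω₂ α β : Type*} [Fintype Ω] [Fintype Ω₁] [Fintype Ω₂]
  [Fintype α] [DecidableEq α] [Fintype β] [DecidableEq β]

lemma prob_eq_sum_ite (p : Ω → ℝ) (X : Ω → α) (a : α) :
    prob p X a = ∑ ω, if X ω = a then p ω else 0 := Finset.sum_filter _ _

lemma prob_nonneg {p : Ω → ℝ} (hp : 0 ≤ p) (X : Ω → α) (a : α) : 0 ≤ prob p X a :=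
  Finset.sum_nonneg fun ω _ => hp ω

lemma sum_prob (p : Ω → ℝ) (X : Ω → α) : ∑ a, prob p X a = ∑ ω, p ω :=
  Finset.sum_fiberwise _ _ _

/-- Agreement is required only off the null set, so that almost sure identities such as `U = X + S`
can be substituted. -/
lemma prob_congr {p : Ω → ℝ} {X X' : Ω → α} (h : ∀ ω, p ω ≠ 0 → X ω = X' ω) (a : α) :
    prob p X a = prob p X' a := by
  simp only [prob_eq_sum_ite]
  refine Finset.sum_congr rfl fun ω _ => ?_
  by_cases h0 : p ω = 0
  · simp [h0]
  · rw [h ω h0]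

lemma entropy_congr {p : Ω → ℝ} {X X' : Ω → α} (h : ∀ ω, p ω ≠ 0 → X ω = X' ω) :
    entropy p X = entropy p X' := by
  simp only [entropy, prob_congr h]

lemma prob_comp_injective (p : Ω → ℝ) (X : Ω → α) {e : α → β} (he : e.Injective) (a : α) :
    prob p (fun ω => e (X ω)) (e a) = prob p X a := by
  simp only [prob, he.eq_iff]

lemma entropy_comp_injective (p : Ω → ℝ) (X : Ω → α) {e : α → β} (he : e.Injective) :
    entropy p (fun ω => e (X ω)) = entropy p X := by
  rw [entropy, entropy, ← Finset.sum_subset (Finset.subset_univ (Finset.univ.map ⟨e, he⟩))]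
  · simp only [Finset.sum_map, Function.Embedding.coeFn_mk, prob_comp_injective p X he]
  · intro b _ hb
    have : prob p (fun ω => e (X ω)) b = 0 := by
      rw [prob, Finset.filter_eq_empty_iff.2, Finset.sum_empty]
      rintro ω - rfl
      exact hb (by simp)
    simp [this]

lemma sum_prob_pair (p : Ω → ℝ) (X : Ω → α) (B : Ω → β) (a : α) :
    ∑ b, prob p (fun ω => (X ω, B ω)) (a, b) = prob p X a := by
  simp only [prob_eq_sum_ite, Prod.mk.injEq]
  rw [Finset.sum_comm]
  refine Finset.sum_congr rfl fun ω _ => ?_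
  by_cases h : X ω = a <;> simp [h]

lemma sum_prob_pair' (p : Ω → ℝ) (X : Ω → α) (B : Ω → β) (b : β) :
    ∑ a, prob p (fun ω => (X ω, B ω)) (a, b) = prob p B b := by
  simp only [prob_eq_sum_ite, Prod.mk.injEq]
  rw [Finset.sum_comm]
  refine Finset.sum_congr rfl fun ω _ => ?_
  by_cases h : B ω = b <;> simp [h]

lemma prob_indep (p : Ω₁ → ℝ) (r : Ω₂ → ℝ) (X : Ω₁ → α) (Z : Ω₂ → β) (a : α) (b : β) :
    prob (fun ω : Ω₁ × Ω₂ => p ω.1 * r ω.2) (fun ω => (X ω.1, Z ω.2)) (a, b) =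
      prob p X a * prob r Z b := by
  simp only [prob_eq_sum_ite, Prod.mk.injEq, Fintype.sum_prod_type, Finset.sum_mul_sum]
  refine Finset.sum_congr rfl fun x _ => Finset.sum_congr rfl fun z _ => ?_
  by_cases h : X x = a <;> by_cases h' : Z z = b <;> simp [h, h']

lemma prob_fst (p : Ω₁ → ℝ) {r : Ω₂ → ℝ} (hr : ∑ ω, r ω = 1) (X : Ω₁ → α) (a : α) :
    prob (fun ω : Ω₁ × Ω₂ => p ω.1 * r ω.2) (fun ω => X ω.1) a = prob p X a := by
  simp only [prob_eq_sum_ite, Fintype.sum_prod_type]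
  refine Finset.sum_congr rfl fun x _ => ?_
  by_cases h : X x = a <;> simp [h, ← Finset.mul_sum, hr]

lemma prob_snd {p : Ω₁ → ℝ} (r : Ω₂ → ℝ) (hp : ∑ ω, p ω = 1) (X : Ω₂ → α) (a : α) :
    prob (fun ω : Ω₁ × Ω₂ => p ω.1 * r ω.2) (fun ω => X ω.2) a = prob r X a := by
  simp only [prob_eq_sum_ite, Fintype.sum_prod_type]
  rw [Finset.sum_comm]
  refine Finset.sum_congr rfl fun x _ => ?_
  by_cases h : X x = a <;> simp [h, ← Finset.sum_mul, hp]

lemma entropy_fst (p : Ω₁ → ℝ) {r : Ω₂ → ℝ} (hr : ∑ ω, r ω = 1) (X : Ω₁ → α) :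
    entropy (fun ω : Ω₁ × Ω₂ => p ω.1 * r ω.2) (fun ω => X ω.1) = entropy p X := by
  simp only [entropy, prob_fst p hr]

lemma entropy_snd {p : Ω₁ → ℝ} (r : Ω₂ → ℝ) (hp : ∑ ω, p ω = 1) (X : Ω₂ → α) :
    entropy (fun ω : Ω₁ × Ω₂ => p ω.1 * r ω.2) (fun ω => X ω.2) = entropy r X := by
  simp only [entropy, prob_snd r hp]

lemma entropy_indep {p : Ω₁ → ℝ} {r : Ω₂ → ℝ} (hp : ∑ ω, p ω = 1) (hr : ∑ ω, r ω = 1)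
    (X : Ω₁ → α) (Z : Ω₂ → β) :
    entropy (fun ω : Ω₁ × Ω₂ => p ω.1 * r ω.2) (fun ω => (X ω.1, Z ω.2)) =
      entropy p X + entropy r Z := by
  simp only [entropy, ← Finset.sum_div, ← add_div, Fintype.sum_prod_type, prob_indep,
    Real.negMulLog_mul, Finset.sum_add_distrib, ← Finset.mul_sum, ← Finset.sum_mul, sum_prob,
    hp, hr, one_mul]

lemma sum_zmod_two {M : Type*} [AddCommMonoid M] (f : ZMod 2 → M) : ∑ b, f b = f 0 + f 1 :=
  Fin.sum_univ_two f

/-- Grouping property of entropy. For `x = 0` the convention `b / 0 = 0` is harmless because of the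
factor `x`. -/
lemma negMulLog_chain {x b : ℝ} (hb : 0 ≤ b) (hbx : b ≤ x) :
    Real.negMulLog (x - b) + Real.negMulLog b - Real.negMulLog x = x * Real.binEntropy (b / x) := by
  rcases (hb.trans hbx).eq_or_lt with rfl | hx
  · obtain rfl := le_antisymm hbx hb
    simp
  · obtain ⟨r, rfl⟩ : ∃ r, b = x * r := ⟨b / x, by field_simp⟩
    rw [mul_div_cancel_left₀ _ hx.ne', show x - x * r = x * (1 - r) by ring, Real.negMulLog_mul,
      Real.negMulLog_mul, Real.binEntropy_eq_negMulLog_add_negMulLog_one_sub]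
    ring

/-- The conditional probability `P(B = 1 | U = u)`. -/
def condProb (p : Ω → ℝ) (U : Ω → α) (B : Ω → ZMod 2) (u : α) : ℝ :=
  prob p (fun ω => (U ω, B ω)) (u, 1) / prob p U u

lemma prob_pair_zero (p : Ω → ℝ) (U : Ω → α) (B : Ω → ZMod 2) (u : α) :
    prob p (fun ω => (U ω, B ω)) (u, 0) = prob p U u - prob p (fun ω => (U ω, B ω)) (u, 1) := by
  rw [← sum_prob_pair p U B, sum_zmod_two]
  ring

lemma prob_pair_le {p : Ω → ℝ} (hp : 0 ≤ p) (U : Ω → α) (B : Ω → β) (u : α) (b : β) :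
    prob p (fun ω => (U ω, B ω)) (u, b) ≤ prob p U u := by
  rw [← sum_prob_pair p U B]
  exact Finset.single_le_sum (f := fun b => prob p (fun ω => (U ω, B ω)) (u, b))
    (fun b _ => prob_nonneg hp _ _) (Finset.mem_univ b)

lemma prob_mul_condProb {p : Ω → ℝ} (hp : 0 ≤ p) (U : Ω → α) (B : Ω → ZMod 2) (u : α) :
    prob p U u * condProb p U B u = prob p (fun ω => (U ω, B ω)) (u, 1) := by
  by_cases h : prob p U u = 0
  · rw [h, zero_mul]
    exact (le_antisymm (h ▸ prob_pair_le hp U B u 1) (prob_nonneg hp _ _)).symm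
  · rw [condProb, mul_div_cancel₀ _ h]

lemma condProb_mem {p : Ω → ℝ} (hp : 0 ≤ p) (U : Ω → α) (B : Ω → ZMod 2) (u : α) :
    condProb p U B u ∈ Set.Icc (0 : ℝ) 1 :=
  ⟨div_nonneg (prob_nonneg hp _ _) (prob_nonneg hp _ _),
    div_le_one_of_le₀ (prob_pair_le hp _ _ _ _) (prob_nonneg hp _ _)⟩

/-- The chain rule for a binary variable: `H(U, B) - H(U) = ∑ P(U = u) H_b(P(B = 1 | U = u))`. -/
lemma entropy_pair_sub {p : Ω → ℝ} (hp : 0 ≤ p) (U : Ω → α) (B : Ω → ZMod 2) :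
    entropy p (fun ω => (U ω, B ω)) - entropy p U =
      ∑ u, prob p U u * Hb (condProb p U B u) := by
  rw [entropy, entropy, Fintype.sum_prod_type, ← Finset.sum_sub_distrib]
  refine Finset.sum_congr rfl fun u _ => ?_
  rw [sum_zmod_two, prob_pair_zero, Hb, condProb, ← mul_div_assoc,
    ← negMulLog_chain (prob_nonneg hp _ _) (prob_pair_le hp _ _ _ _)]
  ring

lemma entropy_binary {p : Ω → ℝ} (h1 : ∑ ω, p ω = 1) (B : Ω → ZMod 2) :
    entropy p B = Hb (prob p B 1) := by
  have h := sum_prob p B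
  rw [sum_zmod_two, h1] at h
  rw [entropy, sum_zmod_two, Hb, Real.binEntropy_eq_negMulLog_add_negMulLog_one_sub,
    ← eq_sub_of_add_eq h]
  ring

/-- Affine functions commute with expectation. -/
lemma sum_prob_mul_tangent {p : Ω → ℝ} (hp : 0 ≤ p) (h1 : ∑ ω, p ω = 1) (t : ℝ) (U : Ω → α)
    (B : Ω → ZMod 2) :
    ∑ u, prob p U u * tangent t (condProb p U B u) = tangent t (prob p B 1) := by
  simp only [tangent_eq t (condProb _ _ _ _), tangent_eq t (prob _ _ _), mul_add, ← mul_assoc,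
    prob_mul_condProb hp, Finset.sum_add_distrib, ← Finset.sum_mul, sum_prob, sum_prob_pair', h1,
    one_mul]

/-- Adding an independent bit mixes `s` with `1 - s`, which have the same entropy, so concavity
applies. -/
lemma Hb_le_Hb_conv {s t : ℝ} (hs : s ∈ Set.Icc (0 : ℝ) 1) (ht : t ∈ Set.Icc (0 : ℝ) 1) :
    Hb s ≤ Hb (s * (1 - t) + (1 - s) * t) := by
  have h := concaveOn_Hb.2 hs (⟨by linarith [hs.2], by linarith [hs.1]⟩ : 1 - s ∈ Set.Icc (0 : ℝ) 1)
    (sub_nonneg.2 ht.2) ht.1 (by ring)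
  simp only [smul_eq_mul, Hb_one_sub] at h
  calc Hb s = (1 - t) * Hb s + t * Hb s := by ring
    _ ≤ _ := h
    _ = _ := by ring_nf

lemma prob_pair_add (p : Ω₁ → ℝ) (r : Ω₂ → ℝ) (U : Ω₁ → α) (V : Ω₂ → β)
    (A : Ω₁ → ZMod 2) (B : Ω₂ → ZMod 2) (u : α) (v : β) :
    prob (fun ω : Ω₁ × Ω₂ => p ω.1 * r ω.2) (fun ω => ((U ω.1, V ω.2), A ω.1 + B ω.2)) ((u, v), 1) =
      prob p (fun ω => (U ω, A ω)) (u, 1) * prob r (fun ω => (V ω, B ω)) (v, 0) +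
      prob p (fun ω => (U ω, A ω)) (u, 0) * prob r (fun ω => (V ω, B ω)) (v, 1) := by
  rw [← prob_indep, ← prob_indep, prob_eq_sum_ite, prob_eq_sum_ite, prob_eq_sum_ite,
    ← Finset.sum_add_distrib]
  refine Finset.sum_congr rfl fun ω _ => ?_
  have key : ∀ a b : ZMod 2, (a = 0 ∧ b = 0) ∨ (a = 0 ∧ b = 1) ∨ (a = 1 ∧ b = 0) ∨
    (a = 1 ∧ b = 1) := by decide
  have h2 : (1 + 1 : ZMod 2) ≠ 1 := by decide
  rcases key (A ω.1) (B ω.2) with h | h | h | h <;> simp [h.1, h.2, h2]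

/-- The entropy of a sum of two conditionally independent bits is at least the average of their
conditional entropies. -/
lemma le_entropy_add {p : Ω₁ → ℝ} {r : Ω₂ → ℝ} (hp : 0 ≤ p) (hr : 0 ≤ r) (hp1 : ∑ ω, p ω = 1)
    (hr1 : ∑ ω, r ω = 1) (U : Ω₁ → α) (V : Ω₂ → β) (A : Ω₁ → ZMod 2) (B : Ω₂ → ZMod 2) :
    (∑ u, prob p U u * Hb (condProb p U A u) + ∑ v, prob r V v * Hb (condProb r V B v)) / 2 ≤
      entropy (fun ω : Ω₁ × Ω₂ => p ω.1 * r ω.2) (fun ω => ((U ω.1, V ω.2), A ω.1 + B ω.2)) -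
        entropy (fun ω : Ω₁ × Ω₂ => p ω.1 * r ω.2) (fun ω => (U ω.1, V ω.2)) := by
  rw [entropy_pair_sub (fun ω => mul_nonneg (hp _) (hr _)) (fun ω : Ω₁ × Ω₂ => (U ω.1, V ω.2)),
    Fintype.sum_prod_type]
  have e : (∑ u, prob p U u * Hb (condProb p U A u) + ∑ v, prob r V v * Hb (condProb r V B v)) / 2
      = ∑ u, ∑ v, prob p U u * prob r V v *
        ((Hb (condProb p U A u) + Hb (condProb r V B v)) / 2) := by
    have h1 : ∑ u, ∑ v, prob p U u * prob r V v * Hb (condProb p U A u) =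
        ∑ u, prob p U u * Hb (condProb p U A u) := by
      refine Finset.sum_congr rfl fun u _ => ?_
      rw [← Finset.sum_mul, ← Finset.mul_sum, sum_prob, hr1, mul_one]
    have h2 : ∑ u, ∑ v, prob p U u * prob r V v * Hb (condProb r V B v) =
        ∑ v, prob r V v * Hb (condProb r V B v) := by
      rw [Finset.sum_comm]
      refine Finset.sum_congr rfl fun v _ => ?_
      rw [← Finset.sum_mul, ← Finset.sum_mul, sum_prob, hp1, one_mul]
    simp only [← mul_div_assoc, mul_add, ← Finset.sum_div, Finset.sum_add_distrib, h1, h2]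
  rw [e]
  refine Finset.sum_le_sum fun u _ => Finset.sum_le_sum fun v _ => ?_
  -- Null atoms contribute nothing and are removed before dividing by their probabilities.
  by_cases h0 : prob p U u * prob r V v = 0
  · rw [prob_indep, h0, zero_mul, zero_mul]
  have hu := left_ne_zero_of_mul h0
  have hv := right_ne_zero_of_mul h0
  have hc : condProb (fun ω : Ω₁ × Ω₂ => p ω.1 * r ω.2) (fun ω => (U ω.1, V ω.2))
      (fun ω => A ω.1 + B ω.2) (u, v) =
      condProb p U A u * (1 - condProb r V B v) + (1 - condProb p U A u) * condProb r V B v := by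
    rw [condProb, prob_indep, prob_pair_add, prob_pair_zero, prob_pair_zero, condProb, condProb]
    field_simp
  rw [prob_indep, hc]
  have hA := condProb_mem hp U A u
  have hB := condProb_mem hr V B v
  have h1 := Hb_le_Hb_conv hA hB
  have h2 := Hb_le_Hb_conv hB hA
  -- Binary convolution is symmetric; its two forms are identified so that both entropy bounds
  -- concern the same number.
  rw [show ∀ s t : ℝ, s * (1 - t) + (1 - s) * t = t * (1 - s) + (1 - t) * s by intros; ring] at h1
  refine mul_le_mul_of_nonneg_left ?_ (mul_nonneg (prob_nonneg hp _ _) (prob_nonneg hr _ _))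
  rw [show ∀ s t : ℝ, s * (1 - t) + (1 - s) * t = t * (1 - s) + (1 - t) * s by intros; ring]
  linarith

/-- The bits `S` and `X + S` differ only where `X = 1`. -/
lemma abs_condProb_sub_le {p : Ω → ℝ} (hp : 0 ≤ p) (U : Ω → α) (S X : Ω → ZMod 2) (u : α) :
    |condProb p U S u - condProb p U (fun ω => X ω + S ω) u| ≤ condProb p U X u := by
  have key : ∀ x s : ZMod 2, (s = 1 → x + s = 1 ∨ x = 1) ∧ (x + s = 1 → s = 1 ∨ x = 1) := by
    decide
  have hle : ∀ f g h : Ω → ZMod 2, (∀ ω, f ω = 1 → g ω = 1 ∨ h ω = 1) →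
      prob p (fun ω => (U ω, f ω)) (u, 1) ≤
        prob p (fun ω => (U ω, g ω)) (u, 1) + prob p (fun ω => (U ω, h ω)) (u, 1) := by
    intro f g h H
    simp only [prob_eq_sum_ite, Prod.mk.injEq, ← Finset.sum_add_distrib]
    refine Finset.sum_le_sum fun ω _ => ?_
    have hω := hp ω
    simp only [Pi.zero_apply] at hω
    have := H ω
    split_ifs <;> first | linarith | tauto
  rw [condProb, condProb, condProb, ← sub_div, abs_div, abs_of_nonneg (prob_nonneg hp U u)]
  refine div_le_div_of_nonneg_right ?_ (prob_nonneg hp U u)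
  rw [abs_sub_le_iff]
  constructor
  · have := hle S (fun ω => X ω + S ω) X fun ω => (key _ _).1
    linarith
  · have := hle (fun ω => X ω + S ω) S X fun ω => (key _ _).2
    linarith

/-- The single-user converse: the pointwise tangent bound at each `u`, averaged over `U`. -/
lemma sum_Hb_sub_le_tangent {p : Ω → ℝ} (hp : 0 ≤ p) (h1 : ∑ ω, p ω = 1) (U : Ω → α)
    (S X : Ω → ZMod 2) {t : ℝ} (ht : qStar ≤ t) (ht₁ : t ≤ 1 / 2) :
    2 * ∑ u, prob p U u * Hb (condProb p U S u) -
      ∑ u, prob p U u * Hb (condProb p U (fun ω => X ω + S ω) u) - 1 ≤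
      tangent t (prob p X 1) := by
  have h := Finset.sum_le_sum fun u (_ : u ∈ Finset.univ) => mul_le_mul_of_nonneg_left
    (Hb_sub_Hb_le_tangent ht ht₁ (condProb_mem hp U S u)
      (condProb_mem hp U (fun ω => X ω + S ω) u) (abs_condProb_sub_le hp U S X u))
    (prob_nonneg hp U u)
  rw [sum_prob_mul_tangent hp h1] at h
  simp only [mul_sub, Finset.sum_sub_distrib, mul_one, sum_prob, h1,
    mul_left_comm _ (2 : ℝ), ← Finset.mul_sum] at h
  exact h

end Entropy

/-! ### The converse for the single-letter region -/

/-- The joint law of `(S, U, X)` of one user. -/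
def userLaw {m : ℕ} (κ : ZMod 2 → Fin m × ZMod 2 → ℝ) : UserSpace m → ℝ :=
  fun ω => 1 / 2 * κ ω.1 ω.2

section Law

variable {m m₁ m₂ : ℕ} {κ : ZMod 2 → Fin m × ZMod 2 → ℝ} {κ₁ : ZMod 2 → Fin m₁ × ZMod 2 → ℝ}
  {κ₂ : ZMod 2 → Fin m₂ × ZMod 2 → ℝ}

lemma law_eq : law κ₁ κ₂ = fun ω => userLaw κ₁ ω.1 * userLaw κ₂ ω.2 := rfl

lemma userLaw_nonneg (h : IsKernel κ) : 0 ≤ userLaw κ :=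
  fun ω => mul_nonneg (by norm_num) ((h ω.1).1 ω.2)

lemma sum_userLaw (h : IsKernel κ) : ∑ ω, userLaw κ ω = 1 := by
  simp only [userLaw, Fintype.sum_prod_type (α₁ := ZMod 2), ← Finset.mul_sum, (h _).2]
  simp

lemma prob_userLaw_state (h : IsKernel κ) (s : ZMod 2) :
    prob (userLaw κ) (fun ω => ω.1) s = 1 / 2 := by
  simp only [prob_eq_sum_ite, Fintype.sum_prod_type (α₁ := ZMod 2), userLaw]
  rw [Finset.sum_eq_single s (fun b _ hb => by simp [hb]) (by simp)]
  simp only [if_true, ← Finset.mul_sum, (h s).2, mul_one]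

lemma entropy_userLaw_state (h : IsKernel κ) : entropy (userLaw κ) (fun ω => ω.1) = 1 := by
  rw [entropy_binary (sum_userLaw h), prob_userLaw_state h, Hb_half]

lemma sum_law (h₁ : IsKernel κ₁) (h₂ : IsKernel κ₂) : ∑ ω, law κ₁ κ₂ ω = 1 := by
  rw [law_eq, Fintype.sum_prod_type]
  simp only [← Finset.mul_sum, sum_userLaw h₂, mul_one, sum_userLaw h₁]

lemma mutualInfo_U1_S1 (h₂ : IsKernel κ₂) :
    mutualInfo (law κ₁ κ₂) U1 S1 =
      mutualInfo (userLaw κ₁) (fun ω => ω.2.1) (fun ω => ω.1) := by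
  have hr := sum_userLaw h₂
  simp only [mutualInfo, law_eq]
  rw [← entropy_fst (userLaw κ₁) hr, ← entropy_fst (userLaw κ₁) hr, ← entropy_fst (userLaw κ₁) hr]
  rfl

lemma mutualInfo_U2_S2 (h₁ : IsKernel κ₁) :
    mutualInfo (law κ₁ κ₂) U2 S2 =
      mutualInfo (userLaw κ₂) (fun ω => ω.2.1) (fun ω => ω.1) := by
  have hp := sum_userLaw h₁
  simp only [mutualInfo, law_eq]
  rw [← entropy_snd (userLaw κ₂) hp, ← entropy_snd (userLaw κ₂) hp, ← entropy_snd (userLaw κ₂) hp]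
  rfl

lemma mutualInfo_userLaw (h : IsKernel κ) :
    mutualInfo (userLaw κ) (fun ω => ω.2.1) (fun ω => ω.1) =
      1 - ∑ u, prob (userLaw κ) (fun ω => ω.2.1) u *
        Hb (condProb (userLaw κ) (fun ω => ω.2.1) (fun ω => ω.1) u) := by
  rw [mutualInfo, entropy_userLaw_state h, ← entropy_pair_sub (userLaw_nonneg h)]
  ring

lemma prob_law_X1 (h₂ : IsKernel κ₂) (x : ZMod 2) :
    prob (law κ₁ κ₂) X1 x = prob (userLaw κ₁) (fun ω => ω.2.2) x :=
  prob_fst (userLaw κ₁) (sum_userLaw h₂) (fun ω => ω.2.2) x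

lemma prob_law_X2 (h₁ : IsKernel κ₁) (x : ZMod 2) :
    prob (law κ₁ κ₂) X2 x = prob (userLaw κ₂) (fun ω => ω.2.2) x :=
  prob_snd (userLaw κ₂) (sum_userLaw h₁) (fun ω => ω.2.2) x

lemma Y_eq (ω : Space m₁ m₂) : Y ω = (ω.1.2.2 + ω.1.1) + (ω.2.2.2 + ω.2.1) := by
  simp only [Y, X1, X2, S1, S2]
  ring

/-- The sum rate of a single-letter scheme is at most the average of the tangent-line bounds at the
two input costs. -/
lemma sumRate_le_tangent (h₁ : IsKernel κ₁) (h₂ : IsKernel κ₂) {t : ℝ} (ht : qStar ≤ t)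
    (ht₁ : t ≤ 1 / 2) :
    mutualInfo (law κ₁ κ₂) (fun ω => (U1 ω, U2 ω)) Y - mutualInfo (law κ₁ κ₂) U1 S1 -
      mutualInfo (law κ₁ κ₂) U2 S2 ≤
      (tangent t (prob (law κ₁ κ₂) X1 1) + tangent t (prob (law κ₁ κ₂) X2 1)) / 2 := by
  rw [mutualInfo_U1_S1 h₂, mutualInfo_U2_S2 h₁, mutualInfo_userLaw h₁,
    mutualInfo_userLaw h₂, prob_law_X1 h₂, prob_law_X2 h₁, mutualInfo,
    entropy_binary (sum_law h₁ h₂) Y]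
  have hY := Hb_le_one (prob (law κ₁ κ₂) Y 1)
  have h := le_entropy_add (userLaw_nonneg h₁) (userLaw_nonneg h₂) (sum_userLaw h₁)
    (sum_userLaw h₂) (fun ω => ω.2.1) (fun ω => ω.2.1) (fun ω => ω.2.2 + ω.1)
    (fun ω => ω.2.2 + ω.1)
  have e₁ : entropy (fun ω : Space m₁ m₂ => userLaw κ₁ ω.1 * userLaw κ₂ ω.2)
      (fun ω => ((ω.1.2.1, ω.2.2.1), (ω.1.2.2 + ω.1.1) + (ω.2.2.2 + ω.2.1))) =
      entropy (law κ₁ κ₂) (fun ω => ((U1 ω, U2 ω), Y ω)) := by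
    simp only [Y_eq]; rfl
  have e₂ : entropy (fun ω : Space m₁ m₂ => userLaw κ₁ ω.1 * userLaw κ₂ ω.2)
      (fun ω => (ω.1.2.1, ω.2.2.1)) = entropy (law κ₁ κ₂) (fun ω => (U1 ω, U2 ω)) := rfl
  rw [e₁, e₂] at h
  have k₁ := sum_Hb_sub_le_tangent (userLaw_nonneg h₁) (sum_userLaw h₁) (fun ω => ω.2.1)
    (fun ω => ω.1) (fun ω => ω.2.2) ht ht₁
  have k₂ := sum_Hb_sub_le_tangent (userLaw_nonneg h₂) (sum_userLaw h₂) (fun ω => ω.2.1)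
    (fun ω => ω.1) (fun ω => ω.2.2) ht ht₁
  linarith

end Law

/-- A half space containing the single-letter region. -/
lemma convexHull_rateCostSet_le {t : ℝ} (ht : qStar ≤ t) (ht₁ : t ≤ 1 / 2) :
    convexHull ℝ rateCostSet ⊆ {v | 0 ≤ v.1.1 ∧ 0 ≤ v.1.2 ∧
      v.1.1 + v.1.2 ≤ (tangent t v.2.1 + tangent t v.2.2) / 2} := by
  refine convexHull_min ?_ ?_
  · rintro ⟨R, c⟩ ⟨m₁, m₂, κ₁, κ₂, h₁, h₂, hR, hc⟩
    simp only at hR hc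
    subst hc
    exact ⟨hR.1, hR.2.1, hR.2.2.2.2.trans (sumRate_le_tangent h₁ h₂ ht ht₁)⟩
  · rintro ⟨⟨a, b⟩, c, d⟩ ⟨h₁, h₂, h₃⟩ ⟨⟨a', b'⟩, c', d'⟩ ⟨h₁', h₂', h₃'⟩ x y hx hy hxy
    simp only [Set.mem_ofPred_eq, Prod.smul_mk, Prod.mk_add_mk, smul_eq_mul] at *
    refine ⟨by positivity, by positivity, ?_⟩
    rw [tangent_affine t x y _ _ hxy, tangent_affine t x y _ _ hxy]
    have := mul_le_mul_of_nonneg_left h₃ hx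
    have := mul_le_mul_of_nonneg_left h₃' hy
    linarith

lemma bslRegion_subset {q : ℝ} (hq₀ : 0 ≤ q) (hq₁ : q ≤ 1 / 2) :
    bslRegion q q ⊆ {R | 0 ≤ R.1 ∧ 0 ≤ R.2 ∧ R.1 + R.2 ≤ bslSumRate q} := by
  refine closure_minimal ?_ ?_
  · rintro R ⟨c, hc, h₁, h₂⟩
    -- The tangent that touches the envelope at `q` turns the half space into the claimed bound.
    obtain ⟨p, hp, hp₁, e⟩ := exists_bslSumRate_eq_tangent hq₀ hq₁
    obtain ⟨a, b, h⟩ := convexHull_rateCostSet_le hp hp₁ hc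
    have hm := tangent_mono (qStar_pos.trans_le hp) hp₁
    refine ⟨a, b, ?_⟩
    have := hm h₁
    have := hm h₂
    simp only at h
    linarith
  · exact (isClosed_le continuous_const continuous_fst).inter
      ((isClosed_le continuous_const continuous_snd).inter
        (isClosed_le (continuous_fst.add continuous_snd) continuous_const))

/-! ### Achievability of the single-letter region -/

/-- The scheme with `U = X ⊕ S` and `X` a `Bernoulli(p)` variable independent of `S`. -/
def dirtyKernel (p : ℝ) : ZMod 2 → Fin 2 × ZMod 2 → ℝ :=
  fun s v => if v.1 = v.2 + s then (if v.2 = 1 then p else 1 - p) else 0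

/-- The scheme with a constant auxiliary variable and zero input. -/
def idleKernel : ZMod 2 → Fin 1 × ZMod 2 → ℝ := fun _ v => if v.2 = 1 then 0 else 1

lemma isKernel_dirtyKernel {p : ℝ} (hp₀ : 0 ≤ p) (hp₁ : p ≤ 1) : IsKernel (dirtyKernel p) := by
  intro s
  refine ⟨fun v => ?_, ?_⟩
  · unfold dirtyKernel
    split_ifs <;> linarith
  · rw [Fintype.sum_prod_type, Finset.sum_comm, sum_zmod_two]
    have key : ∀ s : ZMod 2, s = 0 ∨ s = 1 := by decide
    rcases key s with rfl | rfl <;> simp +decide [dirtyKernel]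

lemma isKernel_idleKernel : IsKernel idleKernel := by
  intro s
  refine ⟨fun v => ?_, ?_⟩
  · unfold idleKernel
    split_ifs <;> norm_num
  · rw [Fintype.sum_prod_type]
    simp [idleKernel, sum_zmod_two]

lemma userLaw_dirtyKernel_ne_zero {p : ℝ} {ω : UserSpace 2} (h : userLaw (dirtyKernel p) ω ≠ 0) :
    ω.2.1 = ω.2.2 + ω.1 := by
  by_contra h'
  exact h (by simp [userLaw, dirtyKernel, h'])

lemma prob_dirtyKernel_X (p : ℝ) : prob (userLaw (dirtyKernel p)) (fun ω => ω.2.2) 1 = p := by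
  simp only [prob_eq_sum_ite, Fintype.sum_prod_type, sum_zmod_two, Fin.sum_univ_two, userLaw,
    dirtyKernel]
  simp +decide
  ring

lemma prob_dirtyKernel_U (p : ℝ) (u : Fin 2) :
    prob (userLaw (dirtyKernel p)) (fun ω => ω.2.1) u = 1 / 2 := by
  simp only [prob_eq_sum_ite, Fintype.sum_prod_type, sum_zmod_two, Fin.sum_univ_two, userLaw,
    dirtyKernel]
  fin_cases u <;> simp +decide <;> ring

lemma entropy_dirtyKernel_U (p : ℝ) :
    entropy (userLaw (dirtyKernel p)) (fun ω => ω.2.1) = 1 := by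
  have := (Real.log_pos one_lt_two).ne'
  simp only [entropy, prob_dirtyKernel_U, Fin.sum_univ_two, Real.negMulLog, one_div, Real.log_inv]
  field_simp
  norm_num

lemma mutualInfo_dirtyKernel {p : ℝ} (hp₀ : 0 ≤ p) (hp₁ : p ≤ 1) :
    mutualInfo (userLaw (dirtyKernel p)) (fun ω => ω.2.1) (fun ω => ω.1) = 1 - Hb p := by
  rw [mutualInfo_userLaw (isKernel_dirtyKernel hp₀ hp₁), Fin.sum_univ_two, prob_dirtyKernel_U,
    prob_dirtyKernel_U, condProb, condProb, prob_dirtyKernel_U, prob_dirtyKernel_U]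
  have h0 : prob (userLaw (dirtyKernel p)) (fun ω => (ω.2.1, ω.1)) (0, 1) = 1 / 2 * p := by
    simp only [prob_eq_sum_ite, Fintype.sum_prod_type, sum_zmod_two, Fin.sum_univ_two, userLaw,
      dirtyKernel]
    simp +decide
  have h1 : prob (userLaw (dirtyKernel p)) (fun ω => (ω.2.1, ω.1)) (1, 1) = 1 / 2 * (1 - p) := by
    simp only [prob_eq_sum_ite, Fintype.sum_prod_type, sum_zmod_two, Fin.sum_univ_two, userLaw,
      dirtyKernel]
    simp +decide
  rw [h0, h1, mul_div_cancel_left₀ _ (by norm_num), mul_div_cancel_left₀ _ (by norm_num),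
    Hb_one_sub]
  ring

/-- The letters of the binary auxiliary alphabet as bits. -/
def toBit (a : Fin 2) : ZMod 2 := a

/-- Almost surely the output is `U₁ + U₂`, so any two of `U₁, U₂, Y` determine the third and every
entropy in the pentagon becomes explicit. -/
lemma Y_dirtyKernel {p r : ℝ} {ω : Space 2 2} (h : law (dirtyKernel p) (dirtyKernel r) ω ≠ 0) :
    Y ω = (toBit ω.1.2.1 + toBit ω.2.2.1 : ZMod 2) := by
  have h₁ := userLaw_dirtyKernel_ne_zero (left_ne_zero_of_mul h)
  have h₂ := userLaw_dirtyKernel_ne_zero (right_ne_zero_of_mul h)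
  rw [Y_eq, ← h₁, ← h₂]
  rfl

section

variable {p r : ℝ} (hp₀ : 0 ≤ p) (hp₁ : p ≤ 1) (hr₀ : 0 ≤ r) (hr₁ : r ≤ 1)

include hp₀ hp₁ hr₀ hr₁

lemma entropy_dirtyKernel_U1_U2 :
    entropy (law (dirtyKernel p) (dirtyKernel r)) (fun ω => (U1 ω, U2 ω)) = 2 := by
  have h := entropy_indep (sum_userLaw (isKernel_dirtyKernel hp₀ hp₁))
    (sum_userLaw (isKernel_dirtyKernel hr₀ hr₁)) (fun ω => ω.2.1) (fun ω => ω.2.1)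
  rw [entropy_dirtyKernel_U, entropy_dirtyKernel_U, one_add_one_eq_two] at h
  exact h

/-- Every variable that determines and is determined by `(U₁, U₂)` has entropy `2`. -/
lemma entropy_dirtyKernel_of_injective {α : Type*} [Fintype α] [DecidableEq α]
    {X : Space 2 2 → α} (e : Fin 2 × Fin 2 → α) (he : e.Injective)
    (h : ∀ ω, law (dirtyKernel p) (dirtyKernel r) ω ≠ 0 → X ω = e (U1 ω, U2 ω)) :
    entropy (law (dirtyKernel p) (dirtyKernel r)) X = 2 := by
  rw [entropy_congr h, entropy_comp_injective _ (fun ω => (U1 ω, U2 ω)) he,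
    entropy_dirtyKernel_U1_U2 hp₀ hp₁ hr₀ hr₁]

lemma entropy_dirtyKernel_Y : entropy (law (dirtyKernel p) (dirtyKernel r)) Y = 1 := by
  have h₁ := isKernel_dirtyKernel hp₀ hp₁
  have h₂ := isKernel_dirtyKernel hr₀ hr₁
  rw [entropy_binary (sum_law h₁ h₂), prob_congr (fun ω => Y_dirtyKernel), ← sum_prob_pair' _ U1]
  have : ∀ a : Fin 2, prob (law (dirtyKernel p) (dirtyKernel r))
      (fun ω => (U1 ω, (toBit ω.1.2.1 + toBit ω.2.2.1 : ZMod 2))) (a, 1) = 1 / 4 := by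
    intro a
    have h := prob_indep (userLaw (dirtyKernel p)) (userLaw (dirtyKernel r)) (fun ω => ω.2.1)
      (fun ω => ω.2.1) a (1 + a)
    rw [prob_dirtyKernel_U, prob_dirtyKernel_U] at h
    rw [show (1 / 4 : ℝ) = 1 / 2 * (1 / 2) by norm_num, ← h]
    -- The pair `(U₁, Y)` is an injective image of `(U₁, U₂)`, so the event `U₁ = a, Y = 1` is `U₁ =
    -- a, U₂ = 1 + a`.
    have hinj : Function.Injective (fun v : Fin 2 × Fin 2 =>
      (v.1, (toBit v.1 + toBit v.2 : ZMod 2))) := by decide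
    have h' := prob_comp_injective (law (dirtyKernel p) (dirtyKernel r))
      (fun ω => (U1 ω, U2 ω)) hinj (a, 1 + a)
    have ha := (by decide : ∀ a, toBit a + toBit (1 + a) = 1) a
    simp only [ha] at h'
    exact h'
  simp only [this, Fin.sum_univ_two]
  rw [show (1 / 4 + 1 / 4 : ℝ) = 1 / 2 by norm_num, Hb_half]

/-- The pentagon of the scheme contains a triangle of sum rate `H_b(p) + H_b(r) - 1`. -/
lemma mem_pentagon_dirtyKernel {R : ℝ × ℝ} (h₁ : 0 ≤ R.1) (h₂ : 0 ≤ R.2)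
    (h : R.1 + R.2 ≤ Hb p + Hb r - 1) : R ∈ pentagon (dirtyKernel p) (dirtyKernel r) := by
  have k₁ := isKernel_dirtyKernel hp₀ hp₁
  have k₂ := isKernel_dirtyKernel hr₀ hr₁
  have hU1 : entropy (law (dirtyKernel p) (dirtyKernel r)) U1 = 1 :=
    (entropy_fst (userLaw (dirtyKernel p)) (sum_userLaw k₂) (fun ω => ω.2.1)).trans
      (entropy_dirtyKernel_U p)
  have hU2 : entropy (law (dirtyKernel p) (dirtyKernel r)) U2 = 1 :=
    (entropy_snd (userLaw (dirtyKernel r)) (sum_userLaw k₁) (fun ω => ω.2.1)).trans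
      (entropy_dirtyKernel_U r)
  have hU := entropy_dirtyKernel_U1_U2 hp₀ hp₁ hr₀ hr₁
  have he {α : Type} [Fintype α] [DecidableEq α] {X : Space 2 2 → α} (e : Fin 2 × Fin 2 → α)
    (he : e.Injective)
    (h : ∀ ω, law (dirtyKernel p) (dirtyKernel r) ω ≠ 0 → X ω = e (U1 ω, U2 ω)) :=
    entropy_dirtyKernel_of_injective hp₀ hp₁ hr₀ hr₁ e he h
  have hp := Hb_le_one p
  have hr := Hb_le_one r
  rw [pentagon, Set.mem_ofPred_eq, condMutualInfo, condMutualInfo, mutualInfo_U1_S1 k₂,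
    mutualInfo_U2_S2 k₁, mutualInfo_dirtyKernel hp₀ hp₁, mutualInfo_dirtyKernel hr₀ hr₁, hU1, hU2,
    hU, mutualInfo, hU, entropy_dirtyKernel_Y hp₀ hp₁ hr₀ hr₁,
    he (X := fun ω => (Y ω, U2 ω))
      (fun v => ((toBit v.1 + toBit v.2 : ZMod 2), v.2)) (by decide)
      (fun ω hω => by rw [Y_dirtyKernel hω]; rfl),
    he (X := fun ω => (Y ω, U1 ω))
      (fun v => ((toBit v.1 + toBit v.2 : ZMod 2), v.1)) (by decide)
      (fun ω hω => by rw [Y_dirtyKernel hω]; rfl),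
    he (X := fun ω => (U1 ω, Y ω, U2 ω))
      (fun v => (v.1, (toBit v.1 + toBit v.2 : ZMod 2), v.2)) (by decide)
      (fun ω hω => by rw [Y_dirtyKernel hω]; rfl),
    he (X := fun ω => (U2 ω, Y ω, U1 ω))
      (fun v => (v.2, (toBit v.1 + toBit v.2 : ZMod 2), v.1)) (by decide)
      (fun ω hω => by rw [Y_dirtyKernel hω]; rfl),
    he (X := fun ω => (U2 ω, U1 ω)) (fun v => (v.2, v.1)) (by decide) (fun ω _ => rfl),
    he (X := fun ω => ((U1 ω, U2 ω), Y ω))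
      (fun v => ((v.1, v.2), (toBit v.1 + toBit v.2 : ZMod 2))) (by decide)
      (fun ω hω => by rw [Y_dirtyKernel hω]; rfl)]
  -- The three bounds are now `Hb p`, `Hb r` and `Hb p + Hb r - 1`; the last implies the others
  -- since entropies are at most `1` and rates nonnegative.
  refine ⟨h₁, h₂, ?_, ?_, ?_⟩ <;> linarith

end

lemma mem_rateCostSet_dirtyKernel {p : ℝ} (hp₀ : 0 ≤ p) (hp₁ : p ≤ 1) {R : ℝ × ℝ} (h₁ : 0 ≤ R.1)
    (h₂ : 0 ≤ R.2) (h : R.1 + R.2 ≤ 2 * Hb p - 1) : (R, (p, p)) ∈ rateCostSet := by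
  have k := isKernel_dirtyKernel hp₀ hp₁
  refine ⟨2, 2, dirtyKernel p, dirtyKernel p, k, k,
    mem_pentagon_dirtyKernel hp₀ hp₁ hp₀ hp₁ h₁ h₂ (by linarith), ?_⟩
  rw [prob_law_X1 k, prob_law_X2 k, prob_dirtyKernel_X]

/-- A variable that is almost surely constant has zero entropy. -/
lemma entropy_of_unique {Ω α : Type*} [Fintype Ω] [Fintype α] [DecidableEq α] {p : Ω → ℝ}
    (h1 : ∑ ω, p ω = 1) {X : Ω → α} (a : α) (h : ∀ ω, p ω ≠ 0 → X ω = a) : entropy p X = 0 := by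
  rw [entropy_congr (X' := fun _ => a) h, entropy]
  refine Finset.sum_eq_zero fun b _ => ?_
  by_cases hb : a = b <;> simp [prob_eq_sum_ite, hb, h1]

lemma prob_idleKernel_X : prob (userLaw idleKernel) (fun ω => ω.2.2) 1 = 0 := by
  simp only [prob_eq_sum_ite, Fintype.sum_prod_type, sum_zmod_two, userLaw, idleKernel]
  simp

/-- The zero-cost partner for time sharing. `dirtyKernel 0` cannot serve: its sum bound is `-1`, so
its pentagon is empty. -/
lemma mem_rateCostSet_zero : ((0, 0), (0, 0)) ∈ rateCostSet := by
  have k := isKernel_idleKernel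
  refine ⟨1, 1, idleKernel, idleKernel, k, k, ?_, ?_⟩
  · have hs := sum_law k k
    have hI : mutualInfo (userLaw idleKernel) (fun ω => ω.2.1) (fun ω => ω.1) = 0 := by
      rw [mutualInfo, entropy_of_unique (sum_userLaw k) 0 fun ω _ => Subsingleton.elim _ _,
        ← entropy_comp_injective _ (fun ω : UserSpace 1 => ω.1) (e := fun s => ((0 : Fin 1), s))
          (fun a b h => (Prod.mk.inj h).2),
        entropy_congr (X := fun ω : UserSpace 1 => ((0 : Fin 1), ω.1))
          (X' := fun ω => (ω.2.1, ω.1)) fun ω _ => by rw [Subsingleton.elim ω.2.1 0]]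
      ring
    have hc : ∀ f g : Fin 1, f = g := Subsingleton.elim
    have h0 {α : Type} [Fintype α] [DecidableEq α] [Subsingleton α] (X : Space 1 1 → α) (a : α) :
      entropy (law idleKernel idleKernel) X = 0 :=
      entropy_of_unique hs a fun ω _ => Subsingleton.elim _ _
    have hY {α : Type} [Fintype α] [DecidableEq α] (e : ZMod 2 → α) (he : e.Injective)
        (X : Space 1 1 → α) (hX : ∀ ω, X ω = e (Y ω)) :
        entropy (law idleKernel idleKernel) X = entropy (law idleKernel idleKernel) Y := by
      rw [funext hX, entropy_comp_injective _ _ he]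
    rw [pentagon, Set.mem_ofPred_eq, mutualInfo_U1_S1 k, mutualInfo_U2_S2 k, hI]
    simp only [condMutualInfo, mutualInfo]
    rw [h0 U1 0, h0 U2 0, h0 (fun ω => (U1 ω, U2 ω)) (0, 0), h0 (fun ω => (U2 ω, U1 ω)) (0, 0),
      hY (fun y => (y, 0)) (by decide) (fun ω => (Y ω, U2 ω)) (fun ω => by rw [hc (U2 ω) 0]),
      hY (fun y => (y, 0)) (by decide) (fun ω => (Y ω, U1 ω)) (fun ω => by rw [hc (U1 ω) 0]),
      hY (fun y => (0, y, 0)) (by decide) (fun ω => (U1 ω, Y ω, U2 ω))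
        (fun ω => by rw [hc (U1 ω) 0, hc (U2 ω) 0]),
      hY (fun y => (0, y, 0)) (by decide) (fun ω => (U2 ω, Y ω, U1 ω))
        (fun ω => by rw [hc (U1 ω) 0, hc (U2 ω) 0]),
      hY (fun y => ((0, 0), y)) (by decide) (fun ω => ((U1 ω, U2 ω), Y ω))
        (fun ω => by rw [hc (U1 ω) 0, hc (U2 ω) 0])]
    simp
  · rw [prob_law_X1 k, prob_law_X2 k, prob_idleKernel_X]

lemma subset_bslRegion {q : ℝ} (hq₀ : 0 ≤ q) (hq₁ : q ≤ 1 / 2) :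
    {R : ℝ × ℝ | 0 ≤ R.1 ∧ 0 ≤ R.2 ∧ R.1 + R.2 ≤ bslSumRate q} ⊆ bslRegion q q := by
  rintro R ⟨h₁, h₂, h⟩
  refine subset_closure ?_
  rcases le_total qStar q with hq | hq
  · rw [bslSumRate_of_qStar_le hq hq₁] at h
    exact ⟨(q, q), subset_convexHull _ _
      (mem_rateCostSet_dirtyKernel hq₀ (by linarith) h₁ h₂ h), le_rfl, le_rfl⟩
  · rw [bslSumRate_of_le_qStar hq₀ hq, CStar] at h
    refine ⟨(q, q), ?_, le_rfl, le_rfl⟩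
    have hs := qStar_pos
    have hs₁ := qStar_lt_half
    rcases hq₀.eq_or_lt with rfl | hq₀
    · rw [mul_zero] at h
      obtain rfl : R = (0, 0) := Prod.ext (by simp; linarith) (by simp; linarith)
      exact subset_convexHull _ _ mem_rateCostSet_zero
    -- The rates are scaled up by `qStar / q`, to be scaled back by using this scheme a fraction `q
    -- / qStar` of the time.
    have hR : (((qStar / q) * R.1, (qStar / q) * R.2), (qStar, qStar)) ∈ rateCostSet := by
      refine mem_rateCostSet_dirtyKernel hs.le (by linarith) ?_ ?_ ?_
      · positivity
      · positivity
      · simp only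
        rw [← mul_add]
        have := mul_le_mul_of_nonneg_left h (div_pos hs hq₀).le
        refine this.trans_eq ?_
        field_simp
    have hc := convex_convexHull ℝ rateCostSet (subset_convexHull _ _ hR)
      (subset_convexHull _ _ mem_rateCostSet_zero) (div_pos hq₀ hs).le
      (sub_nonneg.2 ((div_le_one hs).2 hq)) (by ring)
    convert hc using 1
    ext <;> simp <;> field_simp

/-! ### Random linear maps over `𝔽₂` -/

lemma card_fiber_mul_card {G K : Type*} [AddGroup G] [Fintype G] [AddGroup K] [Fintype K]
    [DecidableEq K] (f : G →+ K) (hf : Function.Surjective f) (k : K) :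
    (Finset.univ.filter fun g => f g = k).card * Fintype.card K = Fintype.card G := by
  have h := Finset.card_eq_sum_card_fiberwise (f := f) (s := Finset.univ) (t := Finset.univ)
    (fun _ _ => Finset.mem_coe.2 (Finset.mem_univ _))
  rw [Finset.sum_congr rfl fun b _ => AddMonoidHom.card_fiber_eq_of_mem_range f
    (hf b) (hf k), Finset.sum_const, smul_eq_mul, mul_comm] at h
  exact h.symm

section Matrices

set_option linter.unusedSectionVars false

variable {n : ℕ} {ι : Type*} [Fintype ι] [DecidableEq ι]

/-- A nonzero vector is in the kernel of a fraction `2 ^ (-|ι|)` of all matrices. -/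
lemma card_mulVec_eq_zero {a : Fin n → ZMod 2} (ha : a ≠ 0) :
    (Finset.univ.filter fun H : Matrix ι (Fin n) (ZMod 2) => H.mulVec a = 0).card *
      2 ^ Fintype.card ι = Fintype.card (Matrix ι (Fin n) (ZMod 2)) := by
  obtain ⟨j, hj⟩ := Function.ne_iff.1 ha
  have hj1 : a j = 1 := by
    have key : ∀ x : ZMod 2, x ≠ 0 → x = 1 := by decide
    exact key _ hj
  -- Evaluation at `a` is onto: since `a j = 1`, the matrix with column `j` equal to `w` and all
  -- others zero is sent to `w`.
  have h := card_fiber_mul_card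
    (AddMonoidHom.mk' (fun H : Matrix ι (Fin n) (ZMod 2) => H.mulVec a)
      fun A B => Matrix.add_mulVec A B a) (fun w => ⟨Matrix.of fun i k => if k = j then w i else 0, by
        ext i
        simp [Matrix.mulVec, dotProduct, hj1]⟩) 0
  simpa using h

/-- The number of pairs of points of `B` that a matrix does not separate. -/
def collisions (B : Finset (Fin n → ZMod 2)) (H : Matrix ι (Fin n) (ZMod 2)) : ℕ :=
  ((B ×ˢ B).filter fun v => H.mulVec v.1 = H.mulVec v.2).card

/-- First moment over all matrices: a diagonal pair always collides, a pair of distinct points with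
probability `2 ^ (-|ι|)`. Denominators are cleared to stay in `ℕ`. -/
lemma exists_collisions_le (B : Finset (Fin n → ZMod 2)) :
    ∃ H : Matrix ι (Fin n) (ZMod 2),
      2 ^ Fintype.card ι * collisions B H ≤ 2 ^ Fintype.card ι * B.card + B.card ^ 2 := by
  have h : ∑ H : Matrix ι (Fin n) (ZMod 2), 2 ^ Fintype.card ι * collisions B H ≤
      ∑ _H : Matrix ι (Fin n) (ZMod 2), (2 ^ Fintype.card ι * B.card + B.card ^ 2) := by
    rw [Finset.sum_const, Finset.card_univ, smul_eq_mul, ← Finset.mul_sum]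
    set N := Fintype.card (Matrix ι (Fin n) (ZMod 2))
    have e : ∑ H : Matrix ι (Fin n) (ZMod 2), collisions B H = ∑ v ∈ B ×ˢ B,
        (Finset.univ.filter fun H : Matrix ι (Fin n) (ZMod 2) =>
          H.mulVec v.1 = H.mulVec v.2).card := by
      simp only [collisions, Finset.card_filter]
      exact Finset.sum_comm
    have hv : ∀ v : (Fin n → ZMod 2) × (Fin n → ZMod 2), 2 ^ Fintype.card ι *
        (Finset.univ.filter fun H : Matrix ι (Fin n) (ZMod 2) =>
          H.mulVec v.1 = H.mulVec v.2).card ≤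
        (if v.1 = v.2 then 2 ^ Fintype.card ι * N else 0) + N := by
      rintro ⟨x, y⟩
      by_cases hxy : x = y
      · simp [hxy, N, Finset.card_univ]
      · have := card_mulVec_eq_zero (ι := ι) (sub_ne_zero.2 hxy)
        simp only [Matrix.mulVec_sub, sub_eq_zero] at this
        simp only [hxy, if_false, zero_add]
        rw [mul_comm, this]
    rw [e, Finset.mul_sum]
    refine (Finset.sum_le_sum fun v _ => hv v).trans_eq ?_
    rw [Finset.sum_add_distrib, Finset.sum_const, Finset.card_product, Finset.sum_product,
      Finset.sum_congr rfl fun x hx => by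
        rw [Finset.sum_ite_eq, if_pos hx], Finset.sum_const]
    simp only [smul_eq_mul]
    ring
  obtain ⟨H, -, hH⟩ := Finset.exists_le_of_sum_le Finset.univ_nonempty h
  exact ⟨H, hH⟩

/-- Cauchy–Schwarz for the fibre sizes: their sum is `|B|` and the sum of their squares counts
collisions. -/
lemma sq_card_le_card_image_mul_collisions (B : Finset (Fin n → ZMod 2))
    (H : Matrix ι (Fin n) (ZMod 2)) :
    B.card ^ 2 ≤ (B.image H.mulVec).card * collisions B H := by
  have h1 : B.card = ∑ w ∈ B.image H.mulVec, (B.filter fun x => H.mulVec x = w).card :=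
    Finset.card_eq_sum_card_fiberwise fun x hx =>
      Finset.mem_coe.2 (Finset.mem_image_of_mem _ (Finset.mem_coe.1 hx))
  have h2 : collisions B H =
      ∑ w ∈ B.image H.mulVec, (B.filter fun x => H.mulVec x = w).card ^ 2 := by
    rw [collisions, Finset.card_eq_sum_card_fiberwise (f := fun v => H.mulVec v.1)
      (t := B.image H.mulVec)]
    · refine Finset.sum_congr rfl fun w _ => ?_
      rw [sq, ← Finset.card_product, Finset.filter_filter, ← Finset.filter_product]
      congr 1
      refine Finset.filter_congr fun v _ => ?_
      constructor
      · rintro ⟨h, h'⟩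
        exact ⟨h', h ▸ h'⟩
      · rintro ⟨h, h'⟩
        exact ⟨h.trans h'.symm, h⟩
    · intro v hv
      simp only [Finset.coe_filter, Finset.mem_product, Set.mem_ofPred_eq] at hv
      exact Finset.mem_coe.2 (Finset.mem_image_of_mem _ hv.1.1)
  rw [h2]
  nth_rewrite 1 [h1]
  exact sq_sum_le_card_mul_sum_sq

/-- If `4 · 2 ^ |ι| ≤ |B|`, some linear map onto `𝔽₂ ^ ι` is surjective and maps `B` onto all but a
fraction `2 ^ |ι| / |B|` of `𝔽₂ ^ ι`. -/
lemma exists_covering_matrix (B : Finset (Fin n → ZMod 2)) (hB : 4 * 2 ^ Fintype.card ι ≤ B.card) :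
    ∃ H : Matrix ι (Fin n) (ZMod 2), Function.Surjective H.mulVec ∧
      ((B.image H.mulVec)ᶜ).card * B.card ≤ 2 ^ Fintype.card ι * 2 ^ Fintype.card ι := by
  obtain ⟨H, hH⟩ := exists_collisions_le (ι := ι) B
  have hC := sq_card_le_card_image_mul_collisions B H
  have hW : Fintype.card (ι → ZMod 2) = 2 ^ Fintype.card ι := by simp
  have hcompl := Finset.card_add_card_compl (B.image H.mulVec)
  rw [hW] at hcompl
  set a := (B.image H.mulVec).card with ha
  set c := ((B.image H.mulVec)ᶜ).card
  set b := B.card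
  set M := 2 ^ Fintype.card ι with hM
  have hMpos : 0 < M := by positivity
  have hb : 0 < b := by omega
  have h1 : b * M ≤ a * (M + b) := by
    have : b * (b * M) ≤ b * (a * (M + b)) := by
      calc b * (b * M) = M * b ^ 2 := by ring
        _ ≤ M * (a * collisions B H) := Nat.mul_le_mul_left _ hC
        _ = a * (M * collisions B H) := by ring
        _ ≤ a * (M * b + b ^ 2) := Nat.mul_le_mul_left _ hH
        _ = b * (a * (M + b)) := by ring
    exact Nat.le_of_mul_le_mul_left this hb
  -- From `b M ≤ a (M + b)` and `a + c = M` comes `c b ≤ a M ≤ M²`.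
  have h2 : c * b ≤ M * M := by nlinarith
  refine ⟨H, ?_, h2⟩
  -- The range then has at least `3M/4` elements; as its order divides `M`, it is everything.
  have h3 : 4 * c ≤ M := by
    by_contra! h
    nlinarith
  let f : (Fin n → ZMod 2) →+ (ι → ZMod 2) :=
    AddMonoidHom.mk' H.mulVec fun x y => Matrix.mulVec_add H x y
  have hle : a ≤ Nat.card f.range := by
    rw [← SetLike.coe_sort_coe, Nat.card_coe_set_eq, ha, ← Set.ncard_coe_finset]
    refine Set.ncard_le_ncard ?_ (Set.toFinite _)
    intro w hw
    obtain ⟨x, -, hx⟩ := Finset.mem_image.1 (Finset.mem_coe.1 hw)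
    exact ⟨x, hx⟩
  have hdvd : Nat.card f.range ∣ M := by
    have := f.range.card_addSubgroup_dvd_card
    rwa [Nat.card_eq_fintype_card (α := ι → ZMod 2), hW] at this
  have htop : f.range = ⊤ := by
    refine AddSubgroup.eq_top_of_card_eq _ ?_
    rw [Nat.card_eq_fintype_card (α := ι → ZMod 2), hW]
    obtain ⟨k, hk⟩ := hdvd
    have hk2 : k < 2 := by
      by_contra! h
      have := Nat.mul_le_mul_left (Nat.card f.range) h
      omega
    interval_cases k
    · omega
    · omega
  exact AddMonoidHom.range_eq_top.1 htop

end Matrices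

/-! ### The size of Hamming balls -/

/-- Unnormalised binomial weights with parameter `k / n` peak at `k`: consecutive terms have ratio
`(n - j) k / ((j + 1)(n - k))`, at least `1` for `j < k` and at most `1` for `j ≥ k`. -/
lemma choose_mul_pow_le {n k : ℕ} (hk : k < n) {j : ℕ} (hj : j ≤ n) :
    n.choose j * k ^ j * (n - k) ^ (n - j) ≤ n.choose k * k ^ k * (n - k) ^ (n - k) := by
  have step : ∀ j < n, (n.choose (j + 1) * k ^ (j + 1) * (n - k) ^ (n - (j + 1))) *
      ((j + 1) * (n - k)) = (n.choose j * k ^ j * (n - k) ^ (n - j)) * ((n - j) * k) := by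
    intro j hj
    have h := Nat.choose_succ_right_eq n j
    have e : n - j = n - (j + 1) + 1 := by omega
    calc _ = (n.choose (j + 1) * (j + 1)) * k ^ (j + 1) * ((n - k) ^ (n - (j + 1)) * (n - k)) := by
          ring
      _ = _ := by
        rw [h, ← pow_succ, ← e]
        ring
  rcases le_total j k with h | h
  · induction h using Nat.decreasingInduction with
    | self => exact le_rfl
    | of_succ i hi ih =>
      refine le_trans ?_ (ih (by omega))
      have hpos : 0 < (i + 1) * (n - k) := Nat.mul_pos (by omega) (by omega)
      refine Nat.le_of_mul_le_mul_right ?_ hpos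
      rw [step i (by omega)]
      refine Nat.mul_le_mul_left _ ?_
      rw [mul_comm]
      exact Nat.mul_le_mul (by omega) (by omega)
  · induction j, h using Nat.le_induction with
    | base => exact le_rfl
    | succ i hi ih =>
      refine le_trans ?_ (ih (by omega))
      have hpos : 0 < (i + 1) * (n - k) := Nat.mul_pos (by omega) (by omega)
      refine Nat.le_of_mul_le_mul_right ?_ hpos
      rw [step i (by omega)]
      refine Nat.mul_le_mul_left _ ?_
      rw [mul_comm]
      exact Nat.mul_le_mul (by omega) (by omega)

/-- Expanding `(k + (n - k)) ^ n` gives `n + 1` terms, none above the peak. -/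
lemma pow_le_succ_mul_choose {n k : ℕ} (hk : k < n) :
    n ^ n ≤ (n + 1) * (n.choose k * k ^ k * (n - k) ^ (n - k)) := by
  have h := add_pow k (n - k) n
  rw [Nat.add_sub_of_le hk.le] at h
  rw [h]
  refine (Finset.sum_le_card_nsmul _ _ (n.choose k * k ^ k * (n - k) ^ (n - k))
    fun j hj => ?_).trans_eq (by simp)
  refine le_trans (le_of_eq ?_) (choose_mul_pow_le hk (Finset.mem_range_succ_iff.1 hj))
  simp only [Nat.cast_id]
  ring

/-- `2 ^ (n H_b(k / n)) ≤ (n + 1) C(n, k)`. -/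
lemma rpow_Hb_le_choose {n k : ℕ} (hk : k < n) (hk₀ : 0 < k) :
    (2 : ℝ) ^ (n * Hb (k / n)) ≤ (n + 1) * n.choose k := by
  have h : ((n : ℝ)) ^ n ≤ (n + 1) * (n.choose k * (k : ℝ) ^ k * ((n - k : ℕ) : ℝ) ^ (n - k)) := by
    exact_mod_cast pow_le_succ_mul_choose hk
  have hn : (0 : ℝ) < n := by exact_mod_cast hk₀.trans hk
  have hkp : (0 : ℝ) < k := by exact_mod_cast hk₀
  have hnk : (0 : ℝ) < ((n - k : ℕ) : ℝ) := by exact_mod_cast Nat.sub_pos_of_lt hk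
  have hl := (Real.log_pos one_lt_two).ne'
  have hcast : ((n - k : ℕ) : ℝ) = n - k := Nat.cast_sub hk.le
  have hC : (0 : ℝ) < n.choose k := by exact_mod_cast Nat.choose_pos hk.le
  have hlog := Real.log_le_log (by positivity) h
  rw [← Real.log_le_log_iff (by positivity) (by positivity), Real.log_rpow two_pos]
  rw [Real.log_mul (by positivity) (by positivity), Real.log_mul (by positivity) (by positivity),
    Real.log_mul (by positivity) (by positivity), Real.log_pow, Real.log_pow, Real.log_pow] at hlog
  rw [Real.log_mul (by positivity) (by positivity)]
  have e : (n : ℝ) * Hb (k / n) * Real.log 2 =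
      n * Real.log n - k * Real.log k - (n - k) * Real.log (n - k : ℕ) := by
    rw [Hb, Real.binEntropy_eq_negMulLog_add_negMulLog_one_sub, Real.negMulLog, Real.negMulLog,
      show (1 : ℝ) - k / n = ((n - k : ℕ) : ℝ) / n by rw [hcast]; field_simp,
      Real.log_div hkp.ne' hn.ne', Real.log_div hnk.ne' hn.ne', hcast]
    field_simp
    ring
  rw [e]
  rw [hcast] at hlog ⊢
  linarith

/-- The Hamming ball of radius `ρ` around `0`. -/
def ball (n : ℕ) (ρ : ℝ) : Finset (Fin n → ZMod 2) :=
  Finset.univ.filter fun x => (hammingNorm x : ℝ) ≤ ρ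

lemma choose_le_card_ball {n k : ℕ} {ρ : ℝ} (hk : (k : ℝ) ≤ ρ) :
    n.choose k ≤ (ball n ρ).card := by
  have h : ((Finset.univ : Finset (Fin n)).powersetCard k).card = n.choose k := by simp
  rw [← h]
  refine Finset.card_le_card_of_injOn (fun s i => if i ∈ s then 1 else 0) ?_ ?_
  · intro s hs
    have hs' := (Finset.mem_powersetCard.1 (Finset.mem_coe.1 hs)).2
    simp only [ball, Finset.coe_filter, Finset.mem_univ, true_and, Set.mem_ofPred_eq, hammingNorm]
    refine le_trans (le_of_eq ?_) hk
    rw [← hs']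
    congr 2
    ext i
    by_cases hi : i ∈ s <;> simp [hi]
  · intro s _ t _ hst
    ext i
    have := congrFun hst i
    by_cases hi : i ∈ s <;> by_cases hi' : i ∈ t <;> simp_all

/-! ### Coset codes -/

section CosetCode

variable {n m₁ m₂ : ℕ}

/-- Binary words as messages. -/
def messageEquiv (m : ℕ) : Fin (2 ^ m) ≃ (Fin m → ZMod 2) :=
  (Fintype.equivFinOfCardEq (by simp)).symm

open Classical in
/-- An element of `B` with the given syndrome, or `0` if there is none. -/
def cosetLeader {ι : Type*} (B : Finset (Fin n → ZMod 2)) (H : Matrix ι (Fin n) (ZMod 2))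
    (w : ι → ZMod 2) : Fin n → ZMod 2 :=
  if h : ∃ x ∈ B, H.mulVec x = w then h.choose else 0

lemma cosetLeader_mem {ι : Type*} {B : Finset (Fin n → ZMod 2)} (hB : 0 ∈ B)
    (H : Matrix ι (Fin n) (ZMod 2)) (w : ι → ZMod 2) : cosetLeader B H w ∈ B := by
  unfold cosetLeader
  split_ifs with h
  · exact h.choose_spec.1
  · exact hB

lemma mulVec_cosetLeader {ι : Type*} [Fintype ι] [DecidableEq ι] {B : Finset (Fin n → ZMod 2)}
    {H : Matrix ι (Fin n) (ZMod 2)} {w : ι → ZMod 2} (hw : w ∈ B.image H.mulVec) :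
    H.mulVec (cosetLeader B H w) = w := by
  have h : ∃ x ∈ B, H.mulVec x = w := Finset.mem_image.1 hw
  rw [cosetLeader, dif_pos h]
  exact h.choose_spec.2

/-- The code in which user `i` shifts the syndrome of its interference by its message, and the
decoder reads off the sum of the two messages from the syndrome of the output. -/
def cosetCode (B : Finset (Fin n → ZMod 2)) (H : Matrix (Fin m₁ ⊕ Fin m₂) (Fin n) (ZMod 2)) :
    Code n (2 ^ m₁) (2 ^ m₂) where
  enc₁ w s := cosetLeader B H (Sum.elim (messageEquiv m₁ w) 0 + H.mulVec s)
  enc₂ w s := cosetLeader B H (Sum.elim (0 : Fin m₁ → ZMod 2) (messageEquiv m₂ w) + H.mulVec s)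
  dec y := ((messageEquiv m₁).symm fun i => H.mulVec y (Sum.inl i),
    (messageEquiv m₂).symm fun i => H.mulVec y (Sum.inr i))

/-- For covered targets `H xᵢ = wᵢ + H sᵢ`, with `wᵢ` padded by zeros. In characteristic two the
output syndrome is the sum of the padded messages, that is, their concatenation. -/
lemma cosetCode_dec {B : Finset (Fin n → ZMod 2)} {H : Matrix (Fin m₁ ⊕ Fin m₂) (Fin n) (ZMod 2)}
    {w₁ : Fin (2 ^ m₁)} {w₂ : Fin (2 ^ m₂)} {s₁ s₂ : Fin n → ZMod 2}
    (h₁ : Sum.elim (messageEquiv m₁ w₁) 0 + H.mulVec s₁ ∈ B.image H.mulVec)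
    (h₂ : Sum.elim (0 : Fin m₁ → ZMod 2) (messageEquiv m₂ w₂) + H.mulVec s₂ ∈ B.image H.mulVec) :
    (cosetCode B H).dec ((cosetCode B H).enc₁ w₁ s₁ + (cosetCode B H).enc₂ w₂ s₂ + s₁ + s₂) =
      (w₁, w₂) := by
  have hH : H.mulVec ((cosetCode B H).enc₁ w₁ s₁ + (cosetCode B H).enc₂ w₂ s₂ + s₁ + s₂) =
      Sum.elim (messageEquiv m₁ w₁) (messageEquiv m₂ w₂) := by
    simp only [cosetCode, Matrix.mulVec_add, mulVec_cosetLeader h₁, mulVec_cosetLeader h₂]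
    have key : ∀ a b x y : ZMod 2, a + x + (b + y) + x + y = a + b := by decide
    ext i
    simp only [Pi.add_apply, key]
    rcases i with i | i <;> simp
  have h : ∀ y, (cosetCode B H).dec y = ((messageEquiv m₁).symm fun i => H.mulVec y (Sum.inl i),
    (messageEquiv m₂).symm fun i => H.mulVec y (Sum.inr i)) := fun _ => rfl
  rw [h, hH]
  simp

/-- A surjective `H` makes `v + H s` uniform when `s` is, whatever the shift `v`. -/
lemma card_shift_mulVec_mem {ι : Type*} [Fintype ι] [DecidableEq ι]
    {H : Matrix ι (Fin n) (ZMod 2)} (hH : Function.Surjective H.mulVec)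
    (A : Finset (ι → ZMod 2)) (v : ι → ZMod 2) :
    (Finset.univ.filter fun s => v + H.mulVec s ∈ A).card * 2 ^ Fintype.card ι =
      2 ^ n * A.card := by
  rw [Finset.card_eq_sum_card_fiberwise (f := fun s => v + H.mulVec s) (t := A)
    (fun s hs => by simpa using hs), Finset.sum_mul, mul_comm (2 ^ n), ← smul_eq_mul,
    ← Finset.sum_const]
  refine Finset.sum_congr rfl fun w hw => ?_
  have h := card_fiber_mul_card (AddMonoidHom.mk' H.mulVec fun x y => Matrix.mulVec_add H x y) hH
    (w - v)
  simp only [Fintype.card_fun, ZMod.card, Fintype.card_fin, AddMonoidHom.mk'_apply] at h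
  rw [← h]
  congr 2
  ext s
  simp only [Finset.mem_filter, Finset.mem_univ, true_and, eq_sub_iff_add_eq']
  constructor
  · exact fun h => h.2
  · exact fun h => ⟨h ▸ hw, h⟩

lemma card_filter_fst_fst {α β γ δ : Type*} [Fintype α] [Fintype β] [Fintype γ] [Fintype δ]
    (P : α → γ → Prop) [∀ a c, Decidable (P a c)] :
    (Finset.univ.filter fun v : (α × β) × γ × δ => P v.1.1 v.2.1).card =
      Fintype.card β * Fintype.card δ * ∑ a, (Finset.univ.filter (P a)).card := by
  have h : ∀ f : α → γ → ℕ, ∑ v : (α × β) × γ × δ, f v.1.1 v.2.1 =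
      Fintype.card β * Fintype.card δ * ∑ x, ∑ y, f x y := by
    intro f
    simp only [Fintype.sum_prod_type, Finset.sum_const, Finset.card_univ, smul_eq_mul,
      ← Finset.mul_sum]
    ring
  simp only [Finset.card_filter]
  exact h fun x y => if P x y then 1 else 0

lemma card_filter_snd_snd {α β γ δ : Type*} [Fintype α] [Fintype β] [Fintype γ] [Fintype δ]
    (P : β → δ → Prop) [∀ b d, Decidable (P b d)] :
    (Finset.univ.filter fun v : (α × β) × γ × δ => P v.1.2 v.2.2).card =
      Fintype.card α * Fintype.card γ * ∑ b, (Finset.univ.filter (P b)).card := by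
  have h : ∀ f : β → δ → ℕ, ∑ v : (α × β) × γ × δ, f v.1.2 v.2.2 =
      Fintype.card α * Fintype.card γ * ∑ x, ∑ y, f x y := by
    intro f
    simp only [Fintype.sum_prod_type, Finset.sum_const, Finset.card_univ, smul_eq_mul,
      ← Finset.mul_sum]
    ring
  simp only [Finset.card_filter]
  exact h fun x y => if P x y then 1 else 0

/-- Union bound: an error forces the target syndrome of one user to be uncovered, and each target is
uniform over the interference. -/
lemma cosetCode_errorProb_le {B : Finset (Fin n → ZMod 2)}
    {H : Matrix (Fin m₁ ⊕ Fin m₂) (Fin n) (ZMod 2)} (hH : Function.Surjective H.mulVec) :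
    (cosetCode B H).errorProb ≤ 2 * (((B.image H.mulVec)ᶜ).card / 2 ^ (m₁ + m₂) : ℝ) := by
  set A := (B.image H.mulVec)ᶜ with hA
  have hK := card_shift_mulVec_mem hH A
  simp only [Fintype.card_sum, Fintype.card_fin] at hK
  have hle : (Finset.univ.filter
      (fun v : (Fin (2 ^ m₁) × Fin (2 ^ m₂)) × (Fin n → ZMod 2) × (Fin n → ZMod 2) =>
        (cosetCode B H).dec ((cosetCode B H).enc₁ v.1.1 v.2.1 + (cosetCode B H).enc₂ v.1.2 v.2.2 +
          v.2.1 + v.2.2) ≠ v.1)).card ≤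
      (Finset.univ.filter
        (fun v : (Fin (2 ^ m₁) × Fin (2 ^ m₂)) × (Fin n → ZMod 2) × (Fin n → ZMod 2) =>
          Sum.elim (messageEquiv m₁ v.1.1) 0 + H.mulVec v.2.1 ∈ A)).card +
      (Finset.univ.filter
        (fun v : (Fin (2 ^ m₁) × Fin (2 ^ m₂)) × (Fin n → ZMod 2) × (Fin n → ZMod 2) =>
          Sum.elim (0 : Fin m₁ → ZMod 2) (messageEquiv m₂ v.1.2) + H.mulVec v.2.2 ∈ A)).card := by
    refine (Finset.card_le_card ?_).trans (Finset.card_union_le _ _)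
    intro v hv
    simp only [Finset.mem_filter, Finset.mem_univ, true_and, Finset.mem_union, hA,
      Finset.mem_compl] at hv ⊢
    by_contra! h
    exact hv (cosetCode_dec h.1 h.2)
  have h₁ : (Finset.univ.filter
        (fun v : (Fin (2 ^ m₁) × Fin (2 ^ m₂)) × (Fin n → ZMod 2) × (Fin n → ZMod 2) =>
          Sum.elim (messageEquiv m₁ v.1.1) 0 + H.mulVec v.2.1 ∈ A)).card * 2 ^ (m₁ + m₂) =
      2 ^ m₁ * 2 ^ m₂ * 2 ^ n * 2 ^ n * A.card := by
    rw [card_filter_fst_fst (fun w (s : Fin n → ZMod 2) => Sum.elim (messageEquiv m₁ w) 0 + H.mulVec s ∈ A),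
      mul_assoc, Finset.sum_mul, Finset.sum_congr rfl fun w _ => hK _]
    simp only [Finset.sum_const, Finset.card_univ, Fintype.card_fin, Fintype.card_fun, ZMod.card,
      smul_eq_mul]
    ring
  have h₂ : (Finset.univ.filter
        (fun v : (Fin (2 ^ m₁) × Fin (2 ^ m₂)) × (Fin n → ZMod 2) × (Fin n → ZMod 2) =>
          Sum.elim (0 : Fin m₁ → ZMod 2) (messageEquiv m₂ v.1.2) + H.mulVec v.2.2 ∈ A)).card * 2 ^ (m₁ + m₂) =
      2 ^ m₁ * 2 ^ m₂ * 2 ^ n * 2 ^ n * A.card := by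
    rw [card_filter_snd_snd (fun w (s : Fin n → ZMod 2) => Sum.elim (0 : Fin m₁ → ZMod 2) (messageEquiv m₂ w) + H.mulVec s ∈ A),
      mul_assoc, Finset.sum_mul, Finset.sum_congr rfl fun w _ => hK _]
    simp only [Finset.sum_const, Finset.card_univ, Fintype.card_fin, Fintype.card_fun, ZMod.card,
      smul_eq_mul]
    ring
  rw [Code.errorProb, ← mul_div_assoc, div_le_div_iff₀ (by positivity) (by positivity)]
  push_cast
  have h := Nat.mul_le_mul_right (2 ^ (m₁ + m₂)) hle
  rw [add_mul, h₁, h₂] at h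
  have h' : (_ : ℝ) ≤ _ := Nat.cast_le.2 h
  push_cast at h'
  refine h'.trans_eq ?_
  ring

end CosetCode

open Filter Topology

/-! ### Achievability for the capacity region -/

lemma exists_code_of_four_mul_le {n m₁ m₂ : ℕ} {q : ℝ} (hq : 0 ≤ q)
    (hB : 4 * 2 ^ (m₁ + m₂) ≤ (ball n (n * q)).card) :
    ∃ c : Code n (2 ^ m₁) (2 ^ m₂), c.MeetsConstraint q q ∧
      c.errorProb ≤ 2 * (2 ^ (m₁ + m₂) / (ball n (n * q)).card : ℝ) := by
  set B := ball n (n * q) with hBdef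
  obtain ⟨H, hH, hc⟩ := exists_covering_matrix (ι := Fin m₁ ⊕ Fin m₂) B (by simpa using hB)
  -- The default coset leader is `0`, so the input constraint holds even on uncovered syndromes.
  have h0 : 0 ∈ B := by
    simp only [hBdef, ball, Finset.mem_filter, Finset.mem_univ, true_and, hammingNorm_zero,
      Nat.cast_zero]
    positivity
  have hmem : ∀ x ∈ B, (hammingNorm x : ℝ) ≤ n * q := fun x hx => (Finset.mem_filter.1 hx).2
  refine ⟨cosetCode B H, ⟨fun w s => hmem _ (cosetLeader_mem h0 _ _),
    fun w s => hmem _ (cosetLeader_mem h0 _ _)⟩, (cosetCode_errorProb_le hH).trans ?_⟩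
  have hBpos : (0 : ℝ) < B.card := by exact_mod_cast Finset.card_pos.2 ⟨0, h0⟩
  refine mul_le_mul_of_nonneg_left ?_ zero_le_two
  rw [div_le_div_iff₀ (by positivity) hBpos]
  simp only [Fintype.card_sum, Fintype.card_fin] at hc
  exact_mod_cast hc

/-- The Hamming ball of radius `n q` has exponentially more than `2 ^ (n r)` elements if
`r < H_b(q)`. -/
lemma tendsto_two_rpow_div_card_ball {q r : ℝ} (hq₀ : 0 < q) (hq₁ : q < 1) (hr : r < Hb q) :
    Tendsto (fun n : ℕ => (2 : ℝ) ^ (n * r) / (ball n (n * q)).card) atTop (𝓝 0) := by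
  -- The margin `η` yields an exponential decay that absorbs the factor `n + 1` of the binomial
  -- estimate.
  obtain ⟨η, hη, hη'⟩ : ∃ η > 0, r + η < Hb q := ⟨(Hb q - r) / 2, by linarith, by linarith⟩
  have hfl : Tendsto (fun n : ℕ => (⌊q * n⌋₊ : ℝ) / n) atTop (𝓝 q) :=
    (tendsto_nat_floor_mul_div_atTop hq₀.le).comp tendsto_natCast_atTop_atTop
  have hHb : Tendsto (fun n : ℕ => Hb ((⌊q * n⌋₊ : ℝ) / n)) atTop (𝓝 (Hb q)) :=
    (continuous_Hb.tendsto q).comp hfl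
  set ρ : ℝ := 2 ^ (-η) with hρ
  have hρ₀ : 0 < ρ := by positivity
  have hρ₁ : ρ < 1 := Real.rpow_lt_one_of_one_lt_of_neg one_lt_two (by linarith)
  have habs : |ρ| < 1 := by rwa [abs_of_pos hρ₀]
  have hlim : Tendsto (fun n : ℕ => ((n : ℝ) + 1) * ρ ^ n) atTop (𝓝 0) := by
    have h1 := tendsto_pow_const_mul_const_pow_of_abs_lt_one 1 habs
    have h2 := tendsto_pow_atTop_nhds_zero_of_abs_lt_one habs
    simpa [add_mul] using h1.add h2
  refine squeeze_zero' (Eventually.of_forall fun n => by positivity) ?_ hlim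
  filter_upwards [hHb.eventually_const_lt hη', hfl.eventually_const_lt hq₀,
    hfl.eventually_lt_const hq₁, eventually_gt_atTop 0] with n h1 h2 h3 hn
  set k := ⌊q * n⌋₊
  have hn' : (0 : ℝ) < n := by exact_mod_cast hn
  have hk₀ : 0 < k := by
    have := (div_pos_iff_of_pos_right hn').1 h2
    exact_mod_cast this
  have hk : k < n := by
    have := (div_lt_one hn').1 h3
    exact_mod_cast this
  have hle : (k : ℝ) ≤ n * q := (Nat.floor_le (by positivity)).trans_eq (mul_comm _ _)
  have hball : (n.choose k : ℝ) ≤ (ball n (n * q)).card := by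
    exact_mod_cast choose_le_card_ball (n := n) hle
  have hC := rpow_Hb_le_choose hk hk₀
  have hchoose : (0 : ℝ) < n.choose k := by exact_mod_cast Nat.choose_pos hk.le
  rw [div_le_iff₀ (hchoose.trans_le hball)]
  have hρn : ρ ^ n = 2 ^ (-(n * η)) := by
    rw [hρ, ← Real.rpow_natCast, ← Real.rpow_mul zero_le_two]
    ring_nf
  calc (2 : ℝ) ^ (n * r) ≤ 2 ^ (-(n * η) + n * Hb (k / n)) := by
        refine Real.rpow_le_rpow_of_exponent_le one_le_two ?_
        nlinarith
    _ = ρ ^ n * 2 ^ (n * Hb (k / n)) := by rw [Real.rpow_add two_pos, hρn]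
    _ ≤ ρ ^ n * ((n + 1) * (ball n (n * q)).card) := by
        gcongr
        exact hC.trans (by gcongr)
    _ = _ := by ring

lemma achievable_of_lt {q : ℝ} (hq₀ : 0 < q) (hq₁ : q < 1) {R : ℝ × ℝ} (h₁ : 0 ≤ R.1)
    (h₂ : 0 ≤ R.2) (h : R.1 + R.2 < Hb q) : Achievable q q R := by
  refine ⟨h₁, h₂, fun ε hε => ?_⟩
  have hlim := tendsto_two_rpow_div_card_ball hq₀ hq₁ h
  -- Rounding both message lengths up costs a factor `4`. Then `1/16` yields the ratio `1/4` needed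
  -- for covering, and `ε/8` yields error `2 · 4 · ε/8 = ε`.
  have hδ : 0 < min (1 / 16) (ε / 8) := by positivity
  obtain ⟨N, hN⟩ := eventually_atTop.1 ((hlim.eventually_lt_const hδ).and (eventually_gt_atTop 0))
  refine ⟨N, fun n hn => ?_⟩
  obtain ⟨hlt, hn0⟩ := hN n hn
  have hn' : (0 : ℝ) < n := by exact_mod_cast hn0
  set m₁ := ⌈n * R.1⌉₊
  set m₂ := ⌈n * R.2⌉₊
  have hm₁ : (m₁ : ℝ) < n * R.1 + 1 := Nat.ceil_lt_add_one (by positivity)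
  have hm₂ : (m₂ : ℝ) < n * R.2 + 1 := Nat.ceil_lt_add_one (by positivity)
  have hpow : (2 : ℝ) ^ (m₁ + m₂) ≤ 4 * 2 ^ (n * (R.1 + R.2)) := by
    calc (2 : ℝ) ^ (m₁ + m₂) = 2 ^ ((m₁ + m₂ : ℕ) : ℝ) := (Real.rpow_natCast _ _).symm
      _ ≤ 2 ^ (2 + n * (R.1 + R.2)) := by
          refine Real.rpow_le_rpow_of_exponent_le one_le_two ?_
          push_cast
          linarith
      _ = _ := by
          rw [Real.rpow_add two_pos]
          norm_num
  have hBpos : (0 : ℝ) < (ball n (n * q)).card := by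
    have : 0 ∈ ball n (n * q) := by
      simp only [ball, Finset.mem_filter, Finset.mem_univ, true_and, hammingNorm_zero,
        Nat.cast_zero]
      positivity
    exact_mod_cast Finset.card_pos.2 ⟨0, this⟩
  have hd : (2 : ℝ) ^ (m₁ + m₂) / (ball n (n * q)).card ≤ 4 * min (1 / 16) (ε / 8) := by
    refine (div_le_div_of_nonneg_right hpow hBpos.le).trans ?_
    rw [mul_div_assoc]
    exact mul_le_mul_of_nonneg_left hlt.le (by norm_num)
  have hmin₁ := min_le_left (1 / 16) (ε / 8)
  have hmin₂ := min_le_right (1 / 16) (ε / 8)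
  have hB : 4 * 2 ^ (m₁ + m₂) ≤ (ball n (n * q)).card := by
    have : (2 : ℝ) ^ (m₁ + m₂) / (ball n (n * q)).card ≤ 1 / 4 := by linarith
    rw [div_le_iff₀ hBpos] at this
    have : (4 : ℝ) * 2 ^ (m₁ + m₂) ≤ (ball n (n * q)).card := by linarith
    exact_mod_cast this
  obtain ⟨c, hc, he⟩ := exists_code_of_four_mul_le hq₀.le hB
  have hlogb : ∀ m : ℕ, Real.logb 2 ((2 ^ m : ℕ) : ℝ) = m := fun m => by
    rw [Nat.cast_pow, Nat.cast_ofNat, Real.logb_pow, Real.logb_self_eq_one one_lt_two, mul_one]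
  refine ⟨2 ^ m₁, 2 ^ m₂, c, hc, ?_, ?_, he.trans (by linarith)⟩
  · rw [hlogb, le_div_iff₀ hn', mul_comm]
    exact Nat.le_ceil _
  · rw [hlogb, le_div_iff₀ hn', mul_comm]
    exact Nat.le_ceil _

/-- Needed at `q = 0`, where no nonnegative pair has sum below `Hb 0 = 0`. With one message per user
no error is possible. -/
lemma achievable_zero {q : ℝ} (hq : 0 ≤ q) : Achievable q q (0, 0) := by
  refine ⟨le_rfl, le_rfl, fun ε hε => ⟨0, fun n _ => ⟨1, 1, ⟨0, 0, 0⟩, ⟨fun w s => ?_,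
    fun w s => ?_⟩, by simp, by simp, ?_⟩⟩⟩
  · simp only [Pi.zero_apply, hammingNorm_zero, Nat.cast_zero]
    positivity
  · simp only [Pi.zero_apply, hammingNorm_zero, Nat.cast_zero]
    positivity
  · rw [Code.errorProb, Finset.filter_eq_empty_iff.2 fun v _ => not_not.2 (Subsingleton.elim _ _)]
    simpa using hε.le

/-- Every nonnegative rate pair with `R₁ + R₂ ≤ H_b(q)` belongs to the capacity region. -/
lemma capacityFormula_subset_capacityRegion {q : ℝ} (hq₀ : 0 ≤ q) (hq₁ : q ≤ 1 / 2) :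
    capacityFormula q q ⊆ capacityRegion q q := by
  rintro R ⟨h₁, h₂, h⟩
  rw [min_self] at h
  rcases hq₀.eq_or_lt with rfl | hq₀
  · rw [Hb_zero] at h
    obtain rfl : R = (0, 0) := Prod.ext (by simp; linarith) (by simp; linarith)
    exact subset_closure (achievable_zero le_rfl)
  have hHb : 0 < Hb q := div_pos (Real.binEntropy_pos hq₀ (by linarith)) (Real.log_pos one_lt_two)
  -- Shrinking `R` by a factor `t < 1` makes the sum constraint strict; the closure recovers `R`.
  have hlim : Tendsto (fun t : ℝ => t • R) (𝓝[<] 1) (𝓝 R) := by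
    have : Tendsto (fun t : ℝ => t • R) (𝓝 1) (𝓝 ((1 : ℝ) • R)) :=
      (continuous_id.smul continuous_const).tendsto 1
    rw [one_smul] at this
    exact this.mono_left nhdsWithin_le_nhds
  refine mem_closure_of_tendsto hlim ?_
  filter_upwards [Ioo_mem_nhdsLT zero_lt_one] with t ht
  refine achievable_of_lt hq₀ (by linarith) (mul_nonneg ht.1.le h₁) (mul_nonneg ht.1.le h₂) ?_
  simp only [Prod.smul_fst, Prod.smul_snd, smul_eq_mul]
  nlinarith [ht.1, ht.2]

end DoublyDirty
end

theorem theorem2 (q : ℝ) (hq₀ : 0 ≤ q) (hq₁ : q ≤ 1 / 2) :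
    DoublyDirty.bslRegion q q =
        {R : ℝ × ℝ | 0 ≤ R.1 ∧ 0 ≤ R.2 ∧ R.1 + R.2 ≤ DoublyDirty.bslSumRate q} ∧
      (DoublyDirty.qStar ≤ q → DoublyDirty.bslSumRate q = 2 * DoublyDirty.Hb q - 1) ∧
      (q ≤ DoublyDirty.qStar → DoublyDirty.bslSumRate q = DoublyDirty.CStar * q) ∧
      DoublyDirty.bslRegion q q ⊆ DoublyDirty.capacityRegion q q ∧
      (0 < q → q < 1 / 2 →
        DoublyDirty.bslRegion q q ⊂ DoublyDirty.capacityRegion q q ∧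
        DoublyDirty.bslRegion q q ⊂ DoublyDirty.capacityFormula q q) := by
  have hcap := DoublyDirty.capacityFormula_subset_capacityRegion hq₀ hq₁
  obtain ⟨hle, hlt⟩ := DoublyDirty.bslSumRate_le_Hb hq₀ hq₁
  have hbsl := DoublyDirty.bslRegion_subset hq₀ hq₁
  have hsub : DoublyDirty.bslRegion q q ⊆ DoublyDirty.capacityFormula q q := fun R hR =>
    ⟨(hbsl hR).1, (hbsl hR).2.1, by rw [min_self]; exact (hbsl hR).2.2.trans hle⟩
  refine ⟨hbsl.antisymm (DoublyDirty.subset_bslRegion hq₀ hq₁),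
    fun h => DoublyDirty.bslSumRate_of_qStar_le h hq₁,
    fun h => DoublyDirty.bslSumRate_of_le_qStar hq₀ h, hsub.trans hcap, fun h h' => ?_⟩
  -- This corner witnesses both strict inclusions.
  have hmem : (DoublyDirty.Hb q, 0) ∈ DoublyDirty.capacityFormula q q :=
    ⟨DoublyDirty.Hb_nonneg hq₀ (by linarith), le_rfl, by simp⟩
  have hnot : (DoublyDirty.Hb q, 0) ∉ DoublyDirty.bslRegion q q := fun hR => by
    have := (hbsl hR).2.2
    simp only [add_zero] at this
    linarith [hlt h h']
  exact ⟨⟨hsub.trans hcap, fun hs => hnot (hs (hcap hmem))⟩, ⟨hsub, fun hs => hnot (hs hmem)⟩⟩
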